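/- Let $d \ge 1$ and $T \ge 1$ be integers with $20(d+1)T > d^2$, and let $A, B > 0$. In each round $t = 1, \dots, T$ of repeated bilateral trade, a learner observes a context $x_t \in \mathbb{R}^d$ with $\|x_t\| \le B$ (Euclidean norm; the sequence is fixed in advance by an oblivious adversary) and posts a price $p_t$ to the seller and $q_t$ to the buyer. The valuations are $s_t = x_t^\top \theta^s$ (seller) and $b_t = x_t^\top \theta^b$ (buyer), where $\theta^s, \theta^b \in \mathbb{R}^d$ are unknown and $\|\theta^s\|, \|\theta^b\| \le A$. The gain from trade is $\mathrm{GFT}_t(p,q) = \mathbf{1}\{s_t \le p\}\,\mathbf{1}\{q \le b_t\}\,(b_t - s_t)$, and the learner then observes the two bits $\mathbf{1}\{s_t \le p_t\}$ and $\mathbf{1}\{q_t \le b_t\}$. The worst-case regret is $$R_T = \sup_{\|\theta^s\|, \|\theta^b\| \le A,\ \|x_1\|, \dots, \|x_T\| \le B}\ \sum_{t=1}^T \Big( \big[x_t^\top(\theta^b - \theta^s)\big]^+ - \mathrm{GFT}_t(p_t,q_t) \Big).$$ An ellipsoid is a set $\{x \in \mathbb{R}^d : (x-c)^\top M^{-1}(x-c)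 \le 1\}$ with $M$ positive definite, and $\mathrm{LJ}(K)$ is the ellipsoid of minimal volume that contains $K$. The algorithm EP-BT with parameter $\varepsilon > 0$ keeps ellipsoids $E^s_t$, $E^b_t$, both initially $\mathrm{LJ}$ of the closed ball of radius $A$ centered at $0$. In round $t$, let $\underline{s}_t, \overline{s}_t$ be the minimum and maximum of $x_t^\top\theta$ over $\theta \in E^s_t$, and $\underline{b}_t, \overline{b}_t$ those over $\theta \in E^b_t$. It posts the same price $p_t = q_t$ to both agents (strong budget balance), as follows: 1. if $\overline{s}_t < \underline{b}_t$, then $p_t = (\overline{s}_t + \underline{b}_t)/2$; 2. otherwise, if $\overline{s}_t - \underline{s}_t \ge \varepsilon$, then $p_t = (\overline{s}_t + \underline{s}_t)/2$, and $E^s_{t+1} = \mathrm{LJ}(E^s_t \cap \{\theta : x_t^\top\theta \le p_t\})$ if the seller accepts ($s_t \le p_t$), $E^s_{t+1} = \mathrm{LJ}(E^s_t \cap \{\theta : x_t^\top\theta > p_t\})$ if not; 3. otherwise, if $\overline{b}_t - \underline{b}_t \ge \varepsilon$, then $p_t = (\overline{b}_t + \underline{b}_t)/2$, and $E^b_{t+1}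 = \mathrm{LJ}(E^b_t \cap \{\theta : x_t^\top\theta \ge p_t\})$ if the buyer accepts ($p_t \le b_t$), $E^b_{t+1} = \mathrm{LJ}(E^b_t \cap \{\theta : x_t^\top\theta < p_t\})$ if not; 4. otherwise $p_t = (\overline{s}_t + \underline{b}_t)/2$. An ellipsoid that is not mentioned in the case at hand stays unchanged. Then EP-BT with $\varepsilon = ABd^2/T$ satisfies strong budget balance, and $$R_T \le 10\,A B d^2 \log\!\big(20(d+1)\,T\,d^{-2}\big).$$ -/

import Mathlib

noncomputable section

namespace BilateralTrade

/-! ### Ellipsoids -/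

/-- The set `E(M, c) = {x | (x - c)ᵀ M⁻¹ (x - c) ≤ 1}`. -/
def ellipsoid {d : ℕ} (M : Matrix (Fin d) (Fin d) ℝ) (c : EuclideanSpace ℝ (Fin d)) :
    Set (EuclideanSpace ℝ (Fin d)) :=
  {x | (x - c).ofLp ⬝ᵥ (M⁻¹).mulVec (x - c).ofLp ≤ 1}

/-- `E` is an ellipsoid: `E = E(M, c)` for a positive definite matrix `M` and a center `c`. -/
def IsEllipsoid {d : ℕ} (E : Set (EuclideanSpace ℝ (Fin d))) : Prop :=
  ∃ (M : Matrix (Fin d) (Fin d) ℝ) (c : EuclideanSpace ℝ (Fin d)),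
    M.PosDef ∧ E = ellipsoid M c

/-- `E` is a minimal volume ellipsoid among those that contain `K`. -/
structure IsLownerJohn {d : ℕ} (K E : Set (EuclideanSpace ℝ (Fin d))) : Prop where
  isEllipsoid : IsEllipsoid E
  subset : K ⊆ E
  volume_le : ∀ E' : Set (EuclideanSpace ℝ (Fin d)), IsEllipsoid E' → K ⊆ E' →
    MeasureTheory.volume E ≤ MeasureTheory.volume E'

open Classical in
/-- The Löwner-John ellipsoid of `K`: the ellipsoid of minimal volume that contains `K`
(the empty set if there is none). -/
def lownerJohn {d : ℕ} (K : Set (EuclideanSpace ℝ (Fin d))) :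
    Set (EuclideanSpace ℝ (Fin d)) :=
  if h : ∃ E, IsLownerJohn K E then h.choose else ∅

/-- The smallest value `min_{θ ∈ E} xᵀ θ` of a context `x` over an uncertainty set `E`. -/
def minVal {d : ℕ} (E : Set (EuclideanSpace ℝ (Fin d))) (x : EuclideanSpace ℝ (Fin d)) : ℝ :=
  sInf ((fun θ => inner ℝ x θ) '' E)

/-- The largest value `max_{θ ∈ E} xᵀ θ` of a context `x` over an uncertainty set `E`. -/
def maxVal {d : ℕ} (E : Set (EuclideanSpace ℝ (Fin d))) (x : EuclideanSpace ℝ (Fin d)) : ℝ :=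
  sSup ((fun θ => inner ℝ x θ) '' E)

/-! ### The learning protocol -/

/-- The gain from trade at prices `p` (to the seller) and `q` (to the buyer), for the seller's
valuation `s` and the buyer's valuation `b`. -/
def gft (s b p q : ℝ) : ℝ :=
  if s ≤ p ∧ q ≤ b then b - s else 0

/-- Two-bit feedback: whether the seller accepts `p`, and whether the buyer accepts `q`. -/
def twoBit (s b p q : ℝ) : Bool × Bool :=
  (decide (s ≤ p), decide (q ≤ b))

/-- A deterministic learner under two-bit feedback. In each round it sees the context, posts the
pair of prices `(p, q)` (`p` to the seller, `q` to the buyer), then sees the two bits and updates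
its memory. -/
structure Learner (d : ℕ) where
  /-- the memory of the learner -/
  State : Type
  /-- the memory at the start of the first round -/
  init : State
  /-- the prices posted to the seller and to the buyer -/
  price : State → EuclideanSpace ℝ (Fin d) → ℝ × ℝ
  /-- the memory after a round, from the old memory, the context and the feedback -/
  update : State → EuclideanSpace ℝ (Fin d) → Bool × Bool → State

/-- Strong budget balance: the same price is posted to the seller and to the buyer. -/
def Learner.StrongBudgetBalance {d : ℕ} (L : Learner d) : Prop :=
  ∀ (σ : L.State) (x : EuclideanSpace ℝ (Fin d)), (L.price σ x).1 = (L.price σ x).2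

/-- The memory of the learner at the start of round `t` (rounds are numbered from `0`), against
the contexts `x 0, x 1, …`, when the valuations in round `t` are `(x t)ᵀ θs` and `(x t)ᵀ θb`. -/
def Learner.state {d : ℕ} (L : Learner d) (θs θb : EuclideanSpace ℝ (Fin d))
    (x : ℕ → EuclideanSpace ℝ (Fin d)) : ℕ → L.State
  | 0 => L.init
  | t + 1 =>
    L.update (L.state θs θb x t) (x t)
      (twoBit (inner ℝ (x t) θs) (inner ℝ (x t) θb)
        (L.price (L.state θs θb x t) (x t)).1 (L.price (L.state θs θb x t) (x t)).2)

/-- The regret over `T` rounds on one instance: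
`∑ₜ ([xₜᵀ (θb - θs)]⁺ - GFTₜ(pₜ, qₜ))`. -/
def Learner.regret {d : ℕ} (L : Learner d) (T : ℕ) (θs θb : EuclideanSpace ℝ (Fin d))
    (x : ℕ → EuclideanSpace ℝ (Fin d)) : ℝ :=
  ∑ t ∈ Finset.range T,
    (max (inner ℝ (x t) (θb - θs)) 0 -
      gft (inner ℝ (x t) θs) (inner ℝ (x t) θb)
        (L.price (L.state θs θb x t) (x t)).1 (L.price (L.state θs θb x t) (x t)).2)

/-- The worst-case regret over `T` rounds: the supremum of the regret over all parameters with
`‖θs‖, ‖θb‖ ≤ A` and all sequences of contexts with `‖xₜ‖ ≤ B` (as an extended real number, so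
that the supremum always exists). -/
def Learner.worstCaseRegret {d : ℕ} (L : Learner d) (A B : ℝ) (T : ℕ) : EReal :=
  ⨆ (θs : EuclideanSpace ℝ (Fin d)) (θb : EuclideanSpace ℝ (Fin d))
    (x : ℕ → EuclideanSpace ℝ (Fin d)) (_ : ‖θs‖ ≤ A) (_ : ‖θb‖ ≤ A)
    (_ : ∀ t < T, ‖x t‖ ≤ B), ((L.regret T θs θb x : ℝ) : EReal)

/-! ### EllipsoidPricing for Bilateral Trade -/

/-- What the algorithm does in a round. -/
inductive Step where
  | exploit
  | exploreSeller
  | exploreBuyer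
  | postAnyway

open Classical in
/-- The case distinction of the algorithm, for uncertainty sets `Es` and `Eb`, the context `x`
and the precision `ε`. -/
def step {d : ℕ} (ε : ℝ) (Es Eb : Set (EuclideanSpace ℝ (Fin d)))
    (x : EuclideanSpace ℝ (Fin d)) : Step :=
  if maxVal Es x < minVal Eb x then Step.exploit
  else if ε ≤ maxVal Es x - minVal Es x then Step.exploreSeller
  else if ε ≤ maxVal Eb x - minVal Eb x then Step.exploreBuyer
  else Step.postAnyway

/-- The price that the algorithm posts to both agents. -/
def epbtPrice {d : ℕ} (ε : ℝ) (Es Eb : Set (EuclideanSpace ℝ (Fin d)))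
    (x : EuclideanSpace ℝ (Fin d)) : ℝ :=
  match step ε Es Eb x with
  | Step.exploit => (maxVal Es x + minVal Eb x) / 2
  | Step.exploreSeller => (maxVal Es x + minVal Es x) / 2
  | Step.exploreBuyer => (maxVal Eb x + minVal Eb x) / 2
  | Step.postAnyway => (maxVal Es x + minVal Eb x) / 2

/-- The part of the seller's uncertainty set that is consistent with the seller's answer `a` to
the price `p`. -/
def sellerCut {d : ℕ} (E : Set (EuclideanSpace ℝ (Fin d))) (x : EuclideanSpace ℝ (Fin d))
    (p : ℝ) (a : Bool) : Set (EuclideanSpace ℝ (Fin d)) :=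
  if a then E ∩ {θ | inner ℝ x θ ≤ p} else E ∩ {θ | p < inner ℝ x θ}

/-- The part of the buyer's uncertainty set that is consistent with the buyer's answer `a` to
the price `p`. -/
def buyerCut {d : ℕ} (E : Set (EuclideanSpace ℝ (Fin d))) (x : EuclideanSpace ℝ (Fin d))
    (p : ℝ) (a : Bool) : Set (EuclideanSpace ℝ (Fin d)) :=
  if a then E ∩ {θ | p ≤ inner ℝ x θ} else E ∩ {θ | inner ℝ x θ < p}

/-- The algorithm EP-BT with parameter `ε` and bound `A`. The memory is the pair of the seller's
and the buyer's uncertainty sets. -/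
def EPBT (d : ℕ) (ε A : ℝ) : Learner d where
  State := Set (EuclideanSpace ℝ (Fin d)) × Set (EuclideanSpace ℝ (Fin d))
  init := (lownerJohn (Metric.closedBall 0 A), lownerJohn (Metric.closedBall 0 A))
  price := fun E x => (epbtPrice ε E.1 E.2 x, epbtPrice ε E.1 E.2 x)
  update := fun E x z =>
    match step ε E.1 E.2 x with
    | Step.exploit => E
    | Step.exploreSeller => (lownerJohn (sellerCut E.1 x (epbtPrice ε E.1 E.2 x) z.1), E.2)
    | Step.exploreBuyer => (E.1, lownerJohn (buyerCut E.2 x (epbtPrice ε E.1 E.2 x) z.2))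
    | Step.postAnyway => E

end BilateralTrade

end

open MeasureTheory Matrix

namespace BilateralTrade

local notation "𝔼" d => EuclideanSpace ℝ (Fin d)

/-! A decreasing volume is played against a lower bound on thickness. Write an ellipsoid as
`ballImage g c`: its volume is proportional to `|det g|`, and its width in direction `x` is `2 *
‖dualMap g x‖`. An exploring round cuts one ellipsoid through its centre. The Löwner-John ellipsoid
of the remaining half is explicit (`lownerJohn_half`), and `|det g|` shrinks by a factor of at most
`exp (-5 / (12 d))` (`halfShape_det_le`). On the other hand, cuts are made only along contexts of
width at least `ε`, and such cuts never push a semiaxis below `r = ε / (20 B (d + 1))`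
(`sq_norm_le_of_wide_cut`). So `n` cuts force `r ^ d ≤ A ^ d * exp (-5 n / (12 d))`, that is, `n ≤
(12/5) d² log (A / r)` (`Localizes.count_le`).

Exploiting costs nothing, an exploring round costs at most `2AB`, and a round of the last case at
most `2ε`, because two overlapping or ordered intervals of length below `ε` leave little gain to
lose. With `ε = ABd²/T` the ratio `A / r` is the argument `z` of the logarithm in the theorem, and
two ellipsoids give a total of `ABd² (9.6 log z + 2)`. This is at most `10 ABd² log z` once `log z ≥
5`. For smaller `z` the trivial bound `2ABT` is enough (`rounds_le_of_log_lt`).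

The explicit ellipsoids are certified by a form of John's criterion (`lownerJohn_eq_ballImage`):
contact points bound the Hilbert-Schmidt norm of the map that compares a competitor with the
candidate, and AM-GM turns this into a determinant bound whose equality case yields uniqueness. -/

/-! ### Ellipsoids as affine images of the unit ball -/

/-- The image of the closed unit ball under `y ↦ c + g y`. -/
def ballImage {d : ℕ} (g : (𝔼 d) ≃ₗ[ℝ] 𝔼 d) (c : 𝔼 d) : Set (𝔼 d) :=
  {θ | ‖g.symm (θ - c)‖ ≤ 1}

theorem mem_ballImage {d : ℕ} {g : (𝔼 d) ≃ₗ[ℝ] 𝔼 d} {c θ : 𝔼 d} :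
    θ ∈ ballImage g c ↔ ‖g.symm (θ - c)‖ ≤ 1 := Iff.rfl

theorem add_mem_ballImage {d : ℕ} {g : (𝔼 d) ≃ₗ[ℝ] 𝔼 d} {c y : 𝔼 d} :
    c + g y ∈ ballImage g c ↔ ‖y‖ ≤ 1 := by
  simp [mem_ballImage]

theorem dotProduct_conjTranspose_mul_self {d : ℕ} (C : Matrix (Fin d) (Fin d) ℝ) (v : 𝔼 d) :
    v.ofLp ⬝ᵥ (Cᴴ * C) *ᵥ v.ofLp = ‖Matrix.toEuclideanLin C v‖ ^ 2 := by
  rw [← real_inner_self_eq_norm_sq, EuclideanSpace.inner_eq_star_dotProduct,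
    ← Matrix.mulVec_mulVec, Matrix.dotProduct_mulVec, conjTranspose_eq_transpose_of_trivial,
    Matrix.vecMul_transpose]
  simp [Matrix.toEuclideanLin, Matrix.toLpLin_apply]

/-- If `C` is the matrix of `g⁻¹`, then `‖g⁻¹ v‖² = vᵀ (CᵀC) v`, so `(CᵀC)⁻¹` serves as `M`. -/
theorem isEllipsoid_ballImage {d : ℕ} (g : (𝔼 d) ≃ₗ[ℝ] 𝔼 d) (c : 𝔼 d) :
    IsEllipsoid (ballImage g c) := by
  obtain ⟨C, hC⟩ := Matrix.toEuclideanLin.surjective (g.symm : (𝔼 d) →ₗ[ℝ] 𝔼 d)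
  have hinj : Function.Injective C.mulVec := by
    intro v w h
    have h2 : g.symm (WithLp.toLp 2 v) = g.symm (WithLp.toLp 2 w) := by
      have : ∀ u, g.symm u = Matrix.toEuclideanLin C u := fun u => by rw [hC]; rfl
      rw [this, this]
      simp [Matrix.toEuclideanLin, Matrix.toLpLin_apply, h]
    simpa using h2
  have hpd : (Cᴴ * C).PosDef := Matrix.PosDef.conjTranspose_mul_self C hinj
  refine ⟨(Cᴴ * C)⁻¹, c, hpd.inv, ?_⟩
  ext θ
  have hunit : IsUnit (Cᴴ * C).det := (Matrix.isUnit_iff_isUnit_det _).1 hpd.isUnit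
  simp only [ellipsoid, Set.mem_ofPred_eq, mem_ballImage, Matrix.nonsing_inv_nonsing_inv _ hunit]
  rw [dotProduct_conjTranspose_mul_self, hC, sq_le_one_iff₀ (norm_nonneg _)]
  rfl

-- Factoring `M⁻¹ = CᵀC` supplies `g = C⁻¹`. Hence competitors for minimal volume may be compared
-- through determinants alone.
open scoped MatrixOrder in
theorem IsEllipsoid.exists_ballImage {d : ℕ} {S : Set (𝔼 d)} (hS : IsEllipsoid S) :
    ∃ g c, S = ballImage g c := by
  obtain ⟨M, c, hM, rfl⟩ := hS
  obtain ⟨C, hC⟩ := CStarAlgebra.nonneg_iff_eq_star_mul_self.mp hM.inv.posSemidef.nonneg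
  rw [Matrix.star_eq_conjTranspose] at hC
  have hu : IsUnit (Cᴴ * C) := hC ▸ hM.inv.isUnit
  have hdet : C.det ≠ 0 := by
    intro h
    have := (Matrix.isUnit_iff_isUnit_det _).1 hu
    simp [Matrix.det_mul, h] at this
  have hinv1 : C * C⁻¹ = 1 := Matrix.mul_nonsing_inv _ (isUnit_iff_ne_zero.2 hdet)
  have hinv2 : C⁻¹ * C = 1 := Matrix.nonsing_inv_mul _ (isUnit_iff_ne_zero.2 hdet)
  refine ⟨LinearEquiv.ofLinearMap (Matrix.toEuclideanLin C⁻¹) (Matrix.toEuclideanLin C) ?_ ?_, c, ?_⟩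
  · rw [Matrix.toEuclideanLin, ← Matrix.toLpLin_mul_same, hinv2, Matrix.toLpLin_one]
  · rw [Matrix.toEuclideanLin, ← Matrix.toLpLin_mul_same, hinv1, Matrix.toLpLin_one]
  · ext θ
    simp only [ellipsoid, Set.mem_ofPred_eq, mem_ballImage, hC]
    rw [dotProduct_conjTranspose_mul_self, sq_le_one_iff₀ (norm_nonneg _)]
    rfl

theorem abs_det_pos {d : ℕ} (g : (𝔼 d) ≃ₗ[ℝ] 𝔼 d) :
    0 < |LinearMap.det (g : (𝔼 d) →ₗ[ℝ] 𝔼 d)| :=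
  abs_pos.2 (LinearEquiv.isUnit_det' g).ne_zero

theorem volume_ballImage {d : ℕ} (g : (𝔼 d) ≃ₗ[ℝ] 𝔼 d) (c : 𝔼 d) :
    volume (ballImage g c) = ENNReal.ofReal |LinearMap.det (g : (𝔼 d) →ₗ[ℝ] 𝔼 d)| *
      volume (Metric.closedBall (0 : 𝔼 d) 1) := by
  have h : ballImage g c = (fun θ => θ + -c) ⁻¹' (g '' Metric.closedBall 0 1) := by
    ext θ
    rw [LinearEquiv.image_eq_preimage_symm]
    simp [mem_ballImage, sub_eq_add_neg]
  rw [h, measure_preimage_add_right]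
  exact Measure.addHaar_image_linearMap volume (g : (𝔼 d) →ₗ[ℝ] 𝔼 d) _

theorem volume_ballImage_le_iff {d : ℕ} (g h : (𝔼 d) ≃ₗ[ℝ] 𝔼 d) (c c' : 𝔼 d) :
    volume (ballImage g c) ≤ volume (ballImage h c') ↔
      |LinearMap.det (g : (𝔼 d) →ₗ[ℝ] 𝔼 d)| ≤ |LinearMap.det (h : (𝔼 d) →ₗ[ℝ] 𝔼 d)| := by
  rw [volume_ballImage, volume_ballImage, ENNReal.mul_le_mul_iff_left
    (Metric.measure_closedBall_pos volume _ one_pos).ne'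
    (isCompact_closedBall _ _).measure_lt_top.ne, ENNReal.ofReal_le_ofReal_iff (abs_nonneg _)]

/-! ### The determinant and the Hilbert-Schmidt norm -/

/-- AM-GM for the eigenvalues: sum `log λ ≤ λ - 1`, which is strict unless `λ = 1`. -/
theorem posDef_det_le_one_of_trace_le {d : ℕ} {P : Matrix (Fin d) (Fin d) ℝ} (hP : P.PosDef)
    (htr : P.trace ≤ d) : P.det ≤ 1 ∧ (P.det = 1 → P = 1) := by
  have hpos := hP.eigenvalues_pos
  have hdet : P.det = ∏ i, hP.1.eigenvalues i := by
    simpa using hP.1.det_eq_prod_eigenvalues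
  have htr' : P.trace = ∑ i, hP.1.eigenvalues i := by
    simpa using hP.1.trace_eq_sum_eigenvalues
  have hlog : Real.log P.det = ∑ i, Real.log (hP.1.eigenvalues i) := by
    rw [hdet, Real.log_prod fun i _ => (hpos i).ne']
  have hsum : ∑ i, (hP.1.eigenvalues i - 1 - Real.log (hP.1.eigenvalues i)) =
      P.trace - d - Real.log P.det := by
    simp [Finset.sum_sub_distrib, htr', hlog]
  have hnn : ∀ i, 0 ≤ hP.1.eigenvalues i - 1 - Real.log (hP.1.eigenvalues i) := fun i => by
    have := Real.log_le_sub_one_of_pos (hpos i)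
    linarith
  have hs : 0 ≤ ∑ i, (hP.1.eigenvalues i - 1 - Real.log (hP.1.eigenvalues i)) :=
    Finset.sum_nonneg fun i _ => hnn i
  refine ⟨?_, fun h1 => ?_⟩
  · have : Real.log P.det ≤ 0 := by linarith
    exact (Real.log_nonpos_iff hP.det_pos.le).1 this
  · have h0 : ∑ i, (hP.1.eigenvalues i - 1 - Real.log (hP.1.eigenvalues i)) = 0 := by
      rw [h1, Real.log_one] at hsum
      linarith
    have hone : hP.1.eigenvalues = fun _ => 1 := by
      funext i
      have hi := (Finset.sum_eq_zero_iff_of_nonneg fun i _ => hnn i).1 h0 i (Finset.mem_univ i)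
      by_contra hne
      have := Real.log_lt_sub_one_of_pos (hpos i) hne
      linarith
    have hspec := hP.1.spectral_theorem
    rw [hone] at hspec
    have : Matrix.diagonal (RCLike.ofReal ∘ fun _ : Fin d => (1 : ℝ)) =
        (1 : Matrix (Fin d) (Fin d) ℝ) := by
      ext i j; simp [Matrix.diagonal, Matrix.one_apply]
    rw [this, map_one] at hspec
    exact hspec

/-- In the basis `b`, the Gram matrix `CᵀC` of `Q` has trace `∑ ‖Q (b j)‖²` and determinant `(det
Q)²`. -/
theorem abs_det_le_one_of_sum_norm_sq_le {d : ℕ} (b : OrthonormalBasis (Fin d) ℝ (𝔼 d))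
    (Q : (𝔼 d) ≃ₗ[ℝ] 𝔼 d) (h : ∑ j, ‖Q (b j)‖ ^ 2 ≤ d) :
    |LinearMap.det (Q : (𝔼 d) →ₗ[ℝ] 𝔼 d)| ≤ 1 ∧
      (|LinearMap.det (Q : (𝔼 d) →ₗ[ℝ] 𝔼 d)| = 1 → ∀ v, ‖Q v‖ = ‖v‖) := by
  set C := LinearMap.toMatrix b.toBasis b.toBasis (Q : (𝔼 d) →ₗ[ℝ] 𝔼 d) with hC
  have hdet : C.det = LinearMap.det (Q : (𝔼 d) →ₗ[ℝ] 𝔼 d) := LinearMap.det_toMatrix _ _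
  have hP : Cᴴ * C = LinearMap.toMatrix b.toBasis b.toBasis
      (LinearMap.adjoint (Q : (𝔼 d) →ₗ[ℝ] 𝔼 d) ∘ₗ (Q : (𝔼 d) →ₗ[ℝ] 𝔼 d)) := by
    rw [LinearMap.toMatrix_comp _ b.toBasis, LinearMap.toMatrix_adjoint]
  have hPij : ∀ i j, (Cᴴ * C) i j = inner ℝ (Q (b i)) (Q (b j)) := by
    intro i j
    rw [hP, LinearMap.toMatrix_apply]
    simp [OrthonormalBasis.repr_apply_apply, LinearMap.adjoint_inner_right]
  have hC0 : C.det ≠ 0 := by rw [hdet]; exact (LinearEquiv.isUnit_det' Q).ne_zero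
  have hpd : (Cᴴ * C).PosDef := Matrix.PosDef.conjTranspose_mul_self C
    (Matrix.mulVec_injective_iff_isUnit.2 ((Matrix.isUnit_iff_isUnit_det _).2
      (isUnit_iff_ne_zero.2 hC0)))
  have hdetP : (Cᴴ * C).det = |LinearMap.det (Q : (𝔼 d) →ₗ[ℝ] 𝔼 d)| ^ 2 := by
    rw [Matrix.det_mul, Matrix.det_conjTranspose, hdet, sq_abs, sq, star_trivial]
  have htr : (Cᴴ * C).trace ≤ d := by
    simpa only [Matrix.trace, Matrix.diag_apply, hPij, real_inner_self_eq_norm_sq] using h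
  obtain ⟨h1, h2⟩ := posDef_det_le_one_of_trace_le hpd htr
  rw [hdetP] at h1 h2
  refine ⟨(sq_le_one_iff₀ (abs_nonneg _)).1 h1, fun h3 v => ?_⟩
  have h4 := h2 (by rw [h3, one_pow])
  rw [hP] at h4
  have h5 : LinearMap.adjoint (Q : (𝔼 d) →ₗ[ℝ] 𝔼 d) ∘ₗ (Q : (𝔼 d) →ₗ[ℝ] 𝔼 d) = LinearMap.id :=
    (LinearMap.toMatrix b.toBasis b.toBasis).injective (by rw [h4, LinearMap.toMatrix_id])
  have h6 : ‖Q v‖ ^ 2 = ‖v‖ ^ 2 := by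
    rw [← real_inner_self_eq_norm_sq, ← real_inner_self_eq_norm_sq]
    calc inner ℝ (Q v) (Q v) = inner ℝ v ((LinearMap.adjoint (Q : (𝔼 d) →ₗ[ℝ] 𝔼 d) ∘ₗ
          (Q : (𝔼 d) →ₗ[ℝ] 𝔼 d)) v) := by
          simp [LinearMap.adjoint_inner_right]
      _ = inner ℝ v v := by rw [h5]; rfl
  exact (sq_eq_sq₀ (norm_nonneg _) (norm_nonneg _)).1 h6

/-! ### A criterion for Löwner-John ellipsoids -/

/-- John's criterion: the hypothesis `hJ` holds as soon as `K`, in the coordinates in which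
`ballImage g c` is the unit ball, has contact points that decompose the identity. -/
theorem lownerJohn_eq_ballImage {d : ℕ} (hd : 1 ≤ d) {K : Set (𝔼 d)} (g : (𝔼 d) ≃ₗ[ℝ] 𝔼 d)
    (c : 𝔼 d) (b : OrthonormalBasis (Fin d) ℝ (𝔼 d)) (hK : K ⊆ ballImage g c)
    (hJ : ∀ (Q : (𝔼 d) ≃ₗ[ℝ] 𝔼 d) (β : 𝔼 d), (∀ y, c + g y ∈ K → ‖Q y - Q β‖ ≤ 1) →
      ∑ j, ‖Q (b j)‖ ^ 2 + d * ‖Q β‖ ^ 2 ≤ d) :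
    lownerJohn K = ballImage g c := by
  have key : ∀ (h : (𝔼 d) ≃ₗ[ℝ] 𝔼 d) (c' : 𝔼 d), K ⊆ ballImage h c' →
      |LinearMap.det (g : (𝔼 d) →ₗ[ℝ] 𝔼 d)| ≤ |LinearMap.det (h : (𝔼 d) →ₗ[ℝ] 𝔼 d)| ∧
      (|LinearMap.det (h : (𝔼 d) →ₗ[ℝ] 𝔼 d)| ≤ |LinearMap.det (g : (𝔼 d) →ₗ[ℝ] 𝔼 d)| →
        ballImage h c' = ballImage g c) := by
    intro h c' hsub
    -- `Q` expresses the candidate in the coordinates of the competitor, so `|det Q| ≤ 1` says that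
    -- the competitor is at least as large.
    set Q := g.trans h.symm with hQ
    have hdetQ : |LinearMap.det (Q : (𝔼 d) →ₗ[ℝ] 𝔼 d)| *
        |LinearMap.det (h : (𝔼 d) →ₗ[ℝ] 𝔼 d)| = |LinearMap.det (g : (𝔼 d) →ₗ[ℝ] 𝔼 d)| := by
      rw [mul_comm, ← abs_mul, ← LinearMap.det_comp]
      congr 2
      ext1 v
      simp [hQ]
    have hb := hJ Q (g.symm (c' - c)) (fun y hy => by
      have := hsub hy
      rw [mem_ballImage] at this
      rw [← map_sub]
      simp only [hQ, LinearEquiv.trans_apply, map_sub, LinearEquiv.apply_symm_apply] at this ⊢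
      convert this using 2
      simp only [map_add]
      abel)
    have hQβ : 0 ≤ (d : ℝ) * ‖Q (g.symm (c' - c))‖ ^ 2 := by positivity
    obtain ⟨h1, h2⟩ := abs_det_le_one_of_sum_norm_sq_le b Q (by linarith)
    have hhpos := abs_det_pos h
    refine ⟨by rw [← hdetQ]; nlinarith, fun hle => ?_⟩
    have h3 : |LinearMap.det (Q : (𝔼 d) →ₗ[ℝ] 𝔼 d)| = 1 := by
      refine le_antisymm h1 ?_
      by_contra hlt
      push Not at hlt
      rw [← hdetQ] at hle
      nlinarith
    have hiso := h2 h3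
    have hsum : ∑ j, ‖Q (b j)‖ ^ 2 = d := by simp [hiso]
    have hd' : (0 : ℝ) < d := by exact_mod_cast hd
    have hz : ‖Q (g.symm (c' - c))‖ ^ 2 ≤ 0 := by
      rw [hsum] at hb
      by_contra hp
      push Not at hp
      nlinarith [mul_pos hd' hp]
    have hz' : c' = c := by
      have : Q (g.symm (c' - c)) = 0 := by
        rw [← norm_eq_zero]
        exact pow_eq_zero_iff two_ne_zero |>.1 (le_antisymm hz (sq_nonneg _))
      simpa [sub_eq_zero] using this
    subst hz'
    ext θ
    rw [mem_ballImage, mem_ballImage, ← hiso (g.symm _)]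
    simp [hQ]
  have hex : IsLownerJohn K (ballImage g c) :=
    ⟨isEllipsoid_ballImage g c, hK, fun E' hE' hKE' => by
      obtain ⟨h, c', rfl⟩ := hE'.exists_ballImage
      exact (volume_ballImage_le_iff _ _ _ _).2 (key h c' hKE').1⟩
  have hne : ∃ E, IsLownerJohn K E := ⟨_, hex⟩
  -- `lownerJohn` picks an arbitrary minimizer, so existence is not enough: the equality case in
  -- `key` identifies the chosen set.
  rw [lownerJohn, dif_pos hne]
  have hsp := hne.choose_spec
  obtain ⟨h, c', hE⟩ := hsp.isEllipsoid.exists_ballImage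
  have hle := hsp.volume_le _ (isEllipsoid_ballImage g c) hK
  have hsub := hsp.subset
  rw [hE] at hle hsub ⊢
  exact (key h c' hsub).2 ((volume_ballImage_le_iff _ _ _ _).1 hle)

/-! ### Scaling along a direction -/

/-- The map that multiplies by `α` along the unit vector `n` and by `β` on its orthogonal
complement. -/
noncomputable def axisScale {d : ℕ} (n : 𝔼 d) (α β : ℝ) : (𝔼 d) →ₗ[ℝ] 𝔼 d :=
  β • LinearMap.id + (α - β) • (innerₛₗ ℝ n).smulRight n

theorem axisScale_apply {d : ℕ} (n : 𝔼 d) (α β : ℝ) (y : 𝔼 d) :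
    axisScale n α β y = β • y + ((α - β) * inner ℝ n y) • n := by
  simp [axisScale, smul_smul]

theorem axisScale_comp {d : ℕ} {n : 𝔼 d} (hn : ‖n‖ = 1) {α β : ℝ} (hα : α ≠ 0) (hβ : β ≠ 0) :
    axisScale n α β ∘ₗ axisScale n α⁻¹ β⁻¹ = LinearMap.id := by
  ext1 y
  simp only [LinearMap.comp_apply, axisScale_apply, inner_add_right, inner_smul_right,
    real_inner_self_eq_norm_sq, hn, LinearMap.id_apply]
  match_scalars
  · field_simp
  · field_simp
    ring

/-- `axisScale` as a linear equivalence. -/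
noncomputable def axisScaleEquiv {d : ℕ} (n : 𝔼 d) (hn : ‖n‖ = 1) (α β : ℝ) (hα : α ≠ 0) (hβ : β ≠ 0) :
    (𝔼 d) ≃ₗ[ℝ] 𝔼 d :=
  LinearEquiv.ofLinearMap (axisScale n α β) (axisScale n α⁻¹ β⁻¹) (axisScale_comp hn hα hβ) (by
    simpa using axisScale_comp hn (inv_ne_zero hα) (inv_ne_zero hβ))

theorem exists_orthonormalBasis_eq {d : ℕ} {n : 𝔼 d} (hn : ‖n‖ = 1) (i₀ : Fin d) :
    ∃ b : OrthonormalBasis (Fin d) ℝ (𝔼 d), b i₀ = n := by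
  have hv : Orthonormal ℝ (({i₀} : Set (Fin d)).domRestrict fun _ => n) := by
    refine ⟨fun _ => hn, fun i j hij => ?_⟩
    exact (hij (Subsingleton.elim i j)).elim
  obtain ⟨b, hb⟩ := hv.exists_orthonormalBasis_extension_of_card_eq (by simp)
  exact ⟨b, hb i₀ rfl⟩

theorem det_axisScale {d : ℕ} (hd : 1 ≤ d) {n : 𝔼 d} (hn : ‖n‖ = 1) (α β : ℝ) :
    LinearMap.det (axisScale n α β) = α * β ^ (d - 1) := by
  obtain ⟨b, hb⟩ := exists_orthonormalBasis_eq hn ⟨0, hd⟩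
  have hM : LinearMap.toMatrix b.toBasis b.toBasis (axisScale n α β) =
      Matrix.diagonal fun i => if i = ⟨0, hd⟩ then α else β := by
    ext i j
    rw [LinearMap.toMatrix_apply]
    have hij := orthonormal_iff_ite.1 b.orthonormal
    simp only [OrthonormalBasis.coe_toBasis, OrthonormalBasis.coe_toBasis_repr_apply,
      OrthonormalBasis.repr_apply_apply, axisScale_apply, inner_add_right, inner_smul_right, ← hb,
      hij, Matrix.diagonal_apply]
    by_cases h1 : i = j <;> by_cases h2 : i = ⟨0, hd⟩
    · subst h1; subst h2; simp
    · subst h1; simp [h2]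
    · have h3 : (⟨0, hd⟩ : Fin d) ≠ j := fun h => h1 (h2.trans h)
      simp [h1, h3]
    · simp [h1, h2]
  rw [← LinearMap.det_toMatrix b.toBasis, hM, Matrix.det_diagonal,
    ← Finset.mul_prod_erase _ _ (Finset.mem_univ (⟨0, hd⟩ : Fin d))]
  have : ∀ i ∈ Finset.univ.erase (⟨0, hd⟩ : Fin d), (if i = ⟨0, hd⟩ then α else β) = β :=
    fun i hi => if_neg (Finset.ne_of_mem_erase hi)
  rw [Finset.prod_congr rfl this, Finset.prod_const]
  simp

theorem norm_axisScale_sq {d : ℕ} {n : 𝔼 d} (hn : ‖n‖ = 1) (α β : ℝ) (w : 𝔼 d) :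
    ‖axisScale n α β w‖ ^ 2 = β ^ 2 * ‖w‖ ^ 2 + (α ^ 2 - β ^ 2) * inner ℝ n w ^ 2 := by
  rw [axisScale_apply, norm_add_sq_real, norm_smul, norm_smul, hn, inner_smul_left,
    inner_smul_right, real_inner_comm]
  simp only [mul_pow, Real.norm_eq_abs, sq_abs, conj_trivial, one_pow]
  ring

theorem inner_axisScale_left {d : ℕ} (n : 𝔼 d) (α β : ℝ) (v w : 𝔼 d) :
    inner ℝ (axisScale n α β v) w = inner ℝ v (axisScale n α β w) := by
  simp only [axisScale_apply, inner_add_left, inner_add_right, inner_smul_left, inner_smul_right,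
    conj_trivial]
  rw [real_inner_comm v n]
  ring

theorem adjoint_axisScale {d : ℕ} (n : 𝔼 d) (α β : ℝ) :
    LinearMap.adjoint (axisScale n α β) = axisScale n α β := by
  symm
  rw [LinearMap.eq_adjoint_iff]
  exact fun x y => inner_axisScale_left n α β x y

/-! ### The Löwner-John ellipsoid of a half ellipsoid -/

/-- The length of the semiaxis along the cut of the Löwner-John ellipsoid of a half ball. -/
noncomputable def axialScale (d : ℕ) : ℝ := d / (d + 1)

/-- The length of the other semiaxes of the Löwner-John ellipsoid of a half ball. -/
noncomputable def radialScale (d : ℕ) : ℝ := if d = 1 then 1 else d / √((d : ℝ) ^ 2 - 1)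

theorem axialScale_pos {d : ℕ} (hd : 1 ≤ d) : 0 < axialScale d := by
  have : (0 : ℝ) < d := by exact_mod_cast hd
  unfold axialScale
  positivity

theorem radialScale_pos {d : ℕ} (hd : 1 ≤ d) : 0 < radialScale d := by
  unfold radialScale
  split_ifs with h
  · exact one_pos
  · have h2 : (2 : ℝ) ≤ d := by exact_mod_cast (by omega : 2 ≤ d)
    have : 0 < (d : ℝ) ^ 2 - 1 := by nlinarith
    positivity

theorem radialScale_sq {d : ℕ} (hd : 2 ≤ d) :
    radialScale d ^ 2 = (d : ℝ) ^ 2 / ((d : ℝ) ^ 2 - 1) := by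
  have h2 : (2 : ℝ) ≤ d := by exact_mod_cast hd
  rw [radialScale, if_neg (by omega), div_pow, Real.sq_sqrt (by nlinarith)]

/-- The shape map of the Löwner-John ellipsoid of the half ball in direction `n`. -/
noncomputable def halfShape {d : ℕ} (hd : 1 ≤ d) (n : 𝔼 d) (hn : ‖n‖ = 1) : (𝔼 d) ≃ₗ[ℝ] 𝔼 d :=
  axisScaleEquiv n hn (axialScale d) (radialScale d) (axialScale_pos hd).ne' (radialScale_pos hd).ne'

theorem halfShape_symm_apply {d : ℕ} (hd : 1 ≤ d) (n : 𝔼 d) (hn : ‖n‖ = 1) (y : 𝔼 d) :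
    (halfShape hd n hn).symm y = axisScale n (axialScale d)⁻¹ (radialScale d)⁻¹ y := rfl

theorem inner_sq_eq_norm_sq_of_one {n : 𝔼 1} (hn : ‖n‖ = 1) (y : 𝔼 1) :
    inner ℝ n y ^ 2 = ‖y‖ ^ 2 := by
  obtain ⟨b, hb⟩ := exists_orthonormalBasis_eq hn 0
  have := b.sum_sq_inner_right y
  simpa [hb] using this

theorem halfBall_subset {d : ℕ} (hd : 1 ≤ d) {n : 𝔼 d} (hn : ‖n‖ = 1) {y : 𝔼 d} (hy : ‖y‖ ≤ 1)
    (hny : 0 ≤ inner ℝ n y) :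
    ‖(halfShape hd n hn).symm (y - ((d : ℝ) + 1)⁻¹ • n)‖ ≤ 1 := by
  have hd0 : (1 : ℝ) ≤ d := by exact_mod_cast hd
  set s : ℝ := inner ℝ n y with hs
  have hs1 : s ≤ 1 := by
    have := real_inner_le_norm n y
    rw [hn] at this; linarith
  have hy2 : ‖y‖ ^ 2 ≤ 1 := by nlinarith [norm_nonneg y]
  have hin : inner ℝ n (y - ((d : ℝ) + 1)⁻¹ • n) = s - ((d : ℝ) + 1)⁻¹ := by
    rw [inner_sub_right, inner_smul_right, real_inner_self_eq_norm_sq, hn]; ring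
  have hno : ‖y - ((d : ℝ) + 1)⁻¹ • n‖ ^ 2 = ‖y‖ ^ 2 - s ^ 2 + (s - ((d : ℝ) + 1)⁻¹) ^ 2 := by
    rw [norm_sub_sq_real, inner_smul_right, norm_smul, hn, real_inner_comm, Real.norm_eq_abs,
      mul_one, sq_abs, ← hs]
    ring
  rw [← sq_le_one_iff₀ (norm_nonneg _), halfShape_symm_apply, norm_axisScale_sq hn, hin, hno]
  have hsplit : (radialScale d)⁻¹ ^ 2 * (‖y‖ ^ 2 - s ^ 2 + (s - ((d : ℝ) + 1)⁻¹) ^ 2) +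
      ((axialScale d)⁻¹ ^ 2 - (radialScale d)⁻¹ ^ 2) * (s - ((d : ℝ) + 1)⁻¹) ^ 2 =
      (radialScale d)⁻¹ ^ 2 * (‖y‖ ^ 2 - s ^ 2) +
      (axialScale d)⁻¹ ^ 2 * (s - ((d : ℝ) + 1)⁻¹) ^ 2 := by ring
  rw [hsplit]
  have hrad : (radialScale d)⁻¹ ^ 2 * (‖y‖ ^ 2 - s ^ 2) ≤
      (((d : ℝ) ^ 2 - 1) / (d : ℝ) ^ 2) * (1 - s ^ 2) := by
    rcases Nat.eq_or_lt_of_le hd with h1 | h1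
    · subst h1
      -- In dimension one the radial part `‖y‖² - s²` is zero, so the conventional value of
      -- `radialScale` is irrelevant.
      rw [← inner_sq_eq_norm_sq_of_one hn y, ← hs]
      simp
    · rw [inv_pow, radialScale_sq h1, inv_div]
      have : 0 ≤ ((d : ℝ) ^ 2 - 1) / (d : ℝ) ^ 2 := by
        apply div_nonneg <;> nlinarith
      exact mul_le_mul_of_nonneg_left (by linarith) this
  refine (add_le_add_left hrad _).trans ?_
  -- The deficit vanishes exactly at `s = 0` and `s = 1`: the contact points are the equator and the
  -- pole.
  have : ((d : ℝ) ^ 2 - 1) / (d : ℝ) ^ 2 * (1 - s ^ 2) +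
      (axialScale d)⁻¹ ^ 2 * (s - ((d : ℝ) + 1)⁻¹) ^ 2 =
      1 - 2 * ((d : ℝ) + 1) * (s * (1 - s)) / (d : ℝ) ^ 2 := by
    unfold axialScale
    field_simp
    ring
  rw [this]
  have : 0 ≤ 2 * ((d : ℝ) + 1) * (s * (1 - s)) / (d : ℝ) ^ 2 := by
    have : 0 ≤ s * (1 - s) := mul_nonneg hny (by linarith)
    positivity
  linarith

/-- A closed condition that holds on the open half ball holds on the closed one. -/
theorem norm_le_one_of_halfBall {d : ℕ} {n : 𝔼 d} (hn : ‖n‖ = 1) (Q : (𝔼 d) ≃ₗ[ℝ] 𝔼 d) (β : 𝔼 d)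
    (h : ∀ y, ‖y‖ ≤ 1 → 0 < inner ℝ n y → ‖Q y - β‖ ≤ 1) {y : 𝔼 d} (hy : ‖y‖ ≤ 1)
    (hny : 0 ≤ inner ℝ n y) : ‖Q y - β‖ ≤ 1 := by
  have hQ : Continuous Q := LinearMap.continuous_of_finiteDimensional (Q : (𝔼 d) →ₗ[ℝ] 𝔼 d)
  have hc : Continuous fun t : ℝ => ‖Q ((1 - t) • y + t • n) - β‖ := by fun_prop
  have hlim : Filter.Tendsto (fun t : ℝ => ‖Q ((1 - t) • y + t • n) - β‖)
      (nhdsWithin 0 (Set.Ioi 0)) (nhds ‖Q y - β‖) := by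
    have := (hc.tendsto 0).mono_left (nhdsWithin_le_nhds (s := Set.Ioi 0))
    simpa using this
  refine le_of_tendsto hlim ?_
  filter_upwards [Ioc_mem_nhdsGT (zero_lt_one' ℝ)] with t ht
  apply h
  · calc ‖(1 - t) • y + t • n‖ ≤ ‖(1 - t) • y‖ + ‖t • n‖ := norm_add_le _ _
      _ = (1 - t) * ‖y‖ + t := by
        rw [norm_smul, norm_smul, hn, Real.norm_of_nonneg (by linarith [ht.2]),
          Real.norm_of_nonneg ht.1.le, mul_one]
      _ ≤ 1 := by nlinarith [ht.1, ht.2]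
  · rw [inner_add_right, inner_smul_right, inner_smul_right, real_inner_self_eq_norm_sq, hn]
    have := mul_nonneg (by linarith [ht.2] : 0 ≤ 1 - t) hny
    have := ht.1
    nlinarith

/-- In normalized coordinates the pole goes to `n` and a unit vector `f` of the equator to `-n/d +
f/radialScale`. The contact inequalities at these points, with weight `d/(d+1)` on the pole and
total weight `d²/(d+1)` on the equator, add up to the claim. -/
theorem halfBall_contact_sum {d : ℕ} (hd : 1 ≤ d) (b : OrthonormalBasis (Fin d) ℝ (𝔼 d))
    (Q : (𝔼 d) ≃ₗ[ℝ] 𝔼 d) (γ : 𝔼 d)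
    (h : ∀ y, ‖y‖ ≤ 1 → 0 ≤ inner ℝ (b ⟨0, hd⟩) y →
      ‖Q ((halfShape hd _ (b.norm_eq_one ⟨0, hd⟩)).symm
        (y - ((d : ℝ) + 1)⁻¹ • b ⟨0, hd⟩)) - γ‖ ≤ 1) :
    ∑ j, ‖Q (b j)‖ ^ 2 + d * ‖γ‖ ^ 2 ≤ d := by
  set i₀ : Fin d := ⟨0, hd⟩
  set n := b i₀ with hnb
  have hn : ‖n‖ = 1 := b.norm_eq_one _
  have hd0 : (1 : ℝ) ≤ d := by exact_mod_cast hd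
  have hα := axialScale_pos hd
  have hβ := radialScale_pos hd
  have hD : ∀ (s : ℝ) (f : 𝔼 d), inner ℝ n f = 0 → (halfShape hd n hn).symm
      ((s • n + f) - ((d : ℝ) + 1)⁻¹ • n) =
      ((axialScale d)⁻¹ * (s - ((d : ℝ) + 1)⁻¹)) • n + (radialScale d)⁻¹ • f := by
    intro s f hf
    rw [halfShape_symm_apply, axisScale_apply]
    simp only [inner_add_right, inner_sub_right, inner_smul_right, hf, real_inner_self_eq_norm_sq,
      hn]
    module
  have hpole : ‖Q n - γ‖ ^ 2 ≤ 1 := by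
    have h1 := h n hn.le (by rw [real_inner_self_eq_norm_sq]; positivity)
    have h2 := hD 1 0 (by simp)
    rw [one_smul, add_zero] at h2
    rw [h2] at h1
    have h3 : (axialScale d)⁻¹ * (1 - ((d : ℝ) + 1)⁻¹) = 1 := by
      unfold axialScale; field_simp; ring
    rw [h3, one_smul, smul_zero, add_zero] at h1
    exact (sq_le_one_iff₀ (norm_nonneg _)).2 h1
  have hcoef : (axialScale d)⁻¹ * (0 - ((d : ℝ) + 1)⁻¹) = -(d : ℝ)⁻¹ := by
    unfold axialScale; field_simp; ring
  -- The parallelogram law averages the conditions at `f` and `-f`, which removes the cross term.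
  have hequator : ∀ f : 𝔼 d, ‖f‖ ≤ 1 → inner ℝ n f = 0 →
      ‖(d : ℝ)⁻¹ • Q n + γ‖ ^ 2 + (radialScale d)⁻¹ ^ 2 * ‖Q f‖ ^ 2 ≤ 1 := by
    intro f hf1 hf
    have h1 := h f hf1 hf.ge
    have h2 := h (-f) (by rwa [norm_neg]) (by rw [inner_neg_right, hf, neg_zero])
    have h1' := hD 0 f hf
    have h2' := hD 0 (-f) (by rw [inner_neg_right, hf, neg_zero])
    rw [zero_smul, zero_add, hcoef] at h1' h2'
    rw [h1', map_add, map_smul, map_smul] at h1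
    rw [h2', map_add, map_smul, map_smul, map_neg] at h2
    have hpar := parallelogram_law_with_norm ℝ ((d : ℝ)⁻¹ • Q n + γ) ((radialScale d)⁻¹ • Q f)
    have e1 : ‖(d : ℝ)⁻¹ • Q n + γ - (radialScale d)⁻¹ • Q f‖ ≤ 1 := by
      rw [← norm_neg]
      exact (congrArg norm (by module)).trans_le h1
    have e2 : ‖(d : ℝ)⁻¹ • Q n + γ + (radialScale d)⁻¹ • Q f‖ ≤ 1 := by
      rw [← norm_neg]
      exact (congrArg norm (by module)).trans_le h2
    rw [norm_smul (radialScale d)⁻¹, Real.norm_of_nonneg (by positivity)] at hpar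
    nlinarith [norm_nonneg ((d : ℝ)⁻¹ • Q n + γ - (radialScale d)⁻¹ • Q f),
      norm_nonneg ((d : ℝ)⁻¹ • Q n + γ + (radialScale d)⁻¹ • Q f)]
  have hsum : ∑ j ∈ Finset.univ.erase i₀, ‖Q (b j)‖ ^ 2 ≤
      (d : ℝ) ^ 2 / (d + 1) * (1 - ‖(d : ℝ)⁻¹ • Q n + γ‖ ^ 2) := by
    rcases Nat.eq_or_lt_of_le hd with h1 | h1
    · have h0 := hequator 0 (by simp) (by simp)
      simp only [map_zero, norm_zero] at h0
      have he : (Finset.univ.erase i₀ : Finset (Fin d)) = ∅ := by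
        rw [← Finset.card_eq_zero, Finset.card_erase_of_mem (Finset.mem_univ _)]
        simp [← h1]
      rw [he, Finset.sum_empty]
      have : 0 ≤ 1 - ‖(d : ℝ)⁻¹ • Q n + γ‖ ^ 2 := by linarith
      positivity
    · have h2 : (2 : ℝ) ≤ d := by exact_mod_cast h1
      have hle : ∀ j ∈ Finset.univ.erase i₀, ‖Q (b j)‖ ^ 2 ≤
          (d : ℝ) ^ 2 / ((d : ℝ) ^ 2 - 1) * (1 - ‖(d : ℝ)⁻¹ • Q n + γ‖ ^ 2) := by
        intro j hj
        have hj0 : inner ℝ n (b j) = 0 := by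
          rw [hnb]
          exact b.orthonormal.2 (Finset.ne_of_mem_erase hj).symm
        have h3 := hequator (b j) (b.norm_eq_one _).le hj0
        rw [inv_pow] at h3
        rw [← radialScale_sq h1]
        have h4 : 0 < radialScale d ^ 2 := by positivity
        have h5 : radialScale d ^ 2 * ((radialScale d ^ 2)⁻¹ * ‖Q (b j)‖ ^ 2) = ‖Q (b j)‖ ^ 2 := by
          field_simp
        nlinarith
      refine (Finset.sum_le_sum hle).trans (le_of_eq ?_)
      rw [Finset.sum_const, Finset.card_erase_of_mem (Finset.mem_univ _), Finset.card_univ,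
        Fintype.card_fin, nsmul_eq_mul, Nat.cast_sub hd, Nat.cast_one, ← mul_assoc]
      congr 1
      have : (d : ℝ) ^ 2 - 1 = (d - 1) * (d + 1) := by ring
      have : (d : ℝ) - 1 ≠ 0 := by linarith
      rw [‹(d : ℝ) ^ 2 - 1 = _›]
      field_simp
  rw [← Finset.add_sum_erase _ _ (Finset.mem_univ i₀), ← hnb]
  have e1 : ‖Q n - γ‖ ^ 2 = ‖Q n‖ ^ 2 - 2 * inner ℝ (Q n) γ + ‖γ‖ ^ 2 := norm_sub_sq_real _ _
  have e2 : ‖(d : ℝ)⁻¹ • Q n + γ‖ ^ 2 =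
      ((d : ℝ)⁻¹) ^ 2 * ‖Q n‖ ^ 2 + 2 * ((d : ℝ)⁻¹ * inner ℝ (Q n) γ) + ‖γ‖ ^ 2 := by
    rw [norm_add_sq_real, norm_smul, inner_smul_left, mul_pow, Real.norm_eq_abs, sq_abs]
    rfl
  -- With these weights the terms in `inner (Q n) γ` match, and only the pole condition remains to
  -- be used.
  have e3 : ‖Q n‖ ^ 2 + (d : ℝ) ^ 2 / (d + 1) * (1 - ‖(d : ℝ)⁻¹ • Q n + γ‖ ^ 2) + d * ‖γ‖ ^ 2 =
      (d : ℝ) ^ 2 / (d + 1) + (d : ℝ) / (d + 1) * ‖Q n - γ‖ ^ 2 := by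
    rw [e1, e2]; field_simp; ring
  have e4 : (d : ℝ) ^ 2 / (d + 1) + (d : ℝ) / (d + 1) = d := by field_simp
  have e5 : (d : ℝ) / (d + 1) * ‖Q n - γ‖ ^ 2 ≤ (d : ℝ) / (d + 1) * 1 :=
    mul_le_mul_of_nonneg_left hpole (by positivity)
  linarith

/-- The Löwner-John ellipsoid of half of an ellipsoid, with or without the cutting hyperplane. -/
theorem lownerJohn_half {d : ℕ} (hd : 1 ≤ d) {K : Set (𝔼 d)} (g : (𝔼 d) ≃ₗ[ℝ] 𝔼 d) (c : 𝔼 d)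
    {n : 𝔼 d} (hn : ‖n‖ = 1)
    (hK1 : ∀ y, ‖y‖ ≤ 1 → 0 < inner ℝ n y → c + g y ∈ K)
    (hK2 : ∀ y, c + g y ∈ K → ‖y‖ ≤ 1 ∧ 0 ≤ inner ℝ n y) :
    lownerJohn K = ballImage ((halfShape hd n hn).trans g) (c + ((d : ℝ) + 1)⁻¹ • g n) := by
  obtain ⟨b, hb⟩ := exists_orthonormalBasis_eq hn ⟨0, hd⟩
  subst hb
  refine lownerJohn_eq_ballImage hd _ _ b ?_ ?_
  · intro θ hθ
    have hy : c + g (g.symm (θ - c)) = θ := by simp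
    obtain ⟨h1, h2⟩ := hK2 (g.symm (θ - c)) (by rwa [hy])
    have := halfBall_subset hd hn h1 h2
    rw [mem_ballImage]
    convert this using 2
    simp only [LinearEquiv.trans_symm, LinearEquiv.trans_apply]
    congr 1
    apply g.injective
    simp [sub_sub]
  · intro Q β hQ
    refine halfBall_contact_sum hd b Q (Q β) fun y hy hny => ?_
    -- `hK1` reaches only the open half ball, while the equatorial contact points lie on its
    -- boundary; they are recovered by a limit.
    have hpt : ∀ z, ‖z‖ ≤ 1 → 0 < inner ℝ (b ⟨0, hd⟩) z →
        ‖((halfShape hd _ hn).symm.trans Q) z -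
          (Q β + ((halfShape hd _ hn).symm.trans Q) (((d : ℝ) + 1)⁻¹ • b ⟨0, hd⟩))‖ ≤ 1 := by
      intro z hz hnz
      have := hQ ((halfShape hd _ hn).symm (z - ((d : ℝ) + 1)⁻¹ • b ⟨0, hd⟩)) (by
        convert hK1 z hz hnz using 1
        simp [map_sub])
      convert this using 2
      simp only [LinearEquiv.trans_apply, map_sub]
      abel
    convert norm_le_one_of_halfBall hn _ _ hpt hy hny using 2
    simp only [LinearEquiv.trans_apply, map_sub]
    abel

/-- A closed ball around the origin is its own Löwner-John ellipsoid. -/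
theorem lownerJohn_closedBall {d : ℕ} (hd : 1 ≤ d) {A : ℝ} (hA : 0 < A) :
    lownerJohn (Metric.closedBall (0 : 𝔼 d) A) =
      ballImage (LinearEquiv.smulOfNeZero ℝ (𝔼 d) A hA.ne') 0 := by
  set b := EuclideanSpace.basisFun (Fin d) ℝ
  have hball : ∀ y : 𝔼 d, ‖y‖ ≤ 1 ↔ (0 : 𝔼 d) + LinearEquiv.smulOfNeZero ℝ (𝔼 d) A hA.ne' y ∈
      Metric.closedBall (0 : 𝔼 d) A := by
    intro y
    simp [LinearEquiv.smulOfNeZero_apply, norm_smul, abs_of_pos hA, hA]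
  refine lownerJohn_eq_ballImage hd _ _ b ?_ ?_
  · intro θ hθ
    rw [mem_ballImage, hball, LinearEquiv.apply_symm_apply]
    simpa using hθ
  · intro Q β hQ
    -- The contact points are `±b j`; averaging them by the parallelogram law cancels the cross
    -- terms.
    have hj : ∀ j, ‖Q (b j)‖ ^ 2 + ‖Q β‖ ^ 2 ≤ 1 := by
      intro j
      have h1 := hQ (b j) ((hball _).1 (b.norm_eq_one j).le)
      have h2 := hQ (-b j) ((hball _).1 (by rw [norm_neg, b.norm_eq_one j]))
      have hpar := parallelogram_law_with_norm ℝ (Q β) (Q (b j))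
      have e1 : ‖Q β - Q (b j)‖ ≤ 1 := by rwa [norm_sub_rev]
      have e2 : ‖Q β + Q (b j)‖ ≤ 1 := by
        rw [← norm_neg]
        exact (congrArg norm (by rw [map_neg]; abel)).trans_le h2
      nlinarith [norm_nonneg (Q β - Q (b j)), norm_nonneg (Q β + Q (b j))]
    have := Finset.sum_le_sum fun j (_ : j ∈ Finset.univ) => hj j
    simpa [Finset.sum_add_distrib] using this

/-! ### Values of a context over an ellipsoid -/

/-- The adjoint of the shape map: `‖dualMap g x‖` is the half width of `ballImage g c` in
direction `x`. -/
noncomputable def dualMap {d : ℕ} (g : (𝔼 d) ≃ₗ[ℝ] 𝔼 d) : (𝔼 d) →ₗ[ℝ] 𝔼 d :=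
  LinearMap.adjoint (g : (𝔼 d) →ₗ[ℝ] 𝔼 d)

theorem inner_dualMap {d : ℕ} (g : (𝔼 d) ≃ₗ[ℝ] 𝔼 d) (x y : 𝔼 d) :
    inner ℝ (dualMap g x) y = inner ℝ x (g y) :=
  LinearMap.adjoint_inner_left _ _ _

theorem inner_add_apply {d : ℕ} (g : (𝔼 d) ≃ₗ[ℝ] 𝔼 d) (x c y : 𝔼 d) :
    inner ℝ x (c + g y) = inner ℝ x c + inner ℝ (dualMap g x) y := by
  rw [inner_add_right, inner_dualMap]

theorem image_inner_ballImage {d : ℕ} (g : (𝔼 d) ≃ₗ[ℝ] 𝔼 d) (c x : 𝔼 d) :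
    IsLeast ((fun θ => inner ℝ x θ) '' ballImage g c) (inner ℝ x c - ‖dualMap g x‖) ∧
    IsGreatest ((fun θ => inner ℝ x θ) '' ballImage g c) (inner ℝ x c + ‖dualMap g x‖) := by
  set z := dualMap g x with hz
  -- For `z = 0` this vector is `0`, by the convention `0⁻¹ = 0`, and still attains the extremum.
  have hunit : ‖‖z‖⁻¹ • z‖ ≤ 1 := by
    rw [norm_smul, norm_inv, norm_norm]
    exact inv_mul_le_one
  have hin : inner ℝ z (‖z‖⁻¹ • z) = ‖z‖ := by
    rw [inner_smul_right, real_inner_self_eq_norm_sq]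
    rcases eq_or_ne ‖z‖ 0 with h | h
    · simp [h]
    · field_simp
  have hbound : ∀ θ ∈ ballImage g c, |inner ℝ x θ - inner ℝ x c| ≤ ‖z‖ := by
    intro θ hθ
    have h1 : inner ℝ x θ = inner ℝ x c + inner ℝ z (g.symm (θ - c)) := by
      rw [hz, ← inner_add_apply]
      simp
    rw [h1, add_sub_cancel_left]
    refine (abs_real_inner_le_norm _ _).trans ?_
    exact mul_le_of_le_one_right (norm_nonneg _) hθ
  refine ⟨⟨⟨c + g (-(‖z‖⁻¹ • z)), add_mem_ballImage.2 (by rwa [norm_neg]), ?_⟩, ?_⟩,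
    ⟨⟨c + g (‖z‖⁻¹ • z), add_mem_ballImage.2 hunit, ?_⟩, ?_⟩⟩
  · simp only [inner_add_apply, inner_neg_right, ← hz, hin, sub_eq_add_neg]
  · rintro _ ⟨θ, hθ, rfl⟩
    have := (abs_le.1 (hbound θ hθ)).1
    dsimp only
    linarith
  · simp only [inner_add_apply, ← hz, hin]
  · rintro _ ⟨θ, hθ, rfl⟩
    have := (abs_le.1 (hbound θ hθ)).2
    dsimp only
    linarith

theorem minVal_ballImage {d : ℕ} (g : (𝔼 d) ≃ₗ[ℝ] 𝔼 d) (c x : 𝔼 d) :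
    minVal (ballImage g c) x = inner ℝ x c - ‖dualMap g x‖ :=
  (image_inner_ballImage g c x).1.csInf_eq

theorem maxVal_ballImage {d : ℕ} (g : (𝔼 d) ≃ₗ[ℝ] 𝔼 d) (c x : 𝔼 d) :
    maxVal (ballImage g c) x = inner ℝ x c + ‖dualMap g x‖ :=
  (image_inner_ballImage g c x).2.csSup_eq

theorem inner_mem_Icc_ballImage {d : ℕ} {g : (𝔼 d) ≃ₗ[ℝ] 𝔼 d} {c θ : 𝔼 d}
    (hθ : θ ∈ ballImage g c) (x : 𝔼 d) :
    inner ℝ x θ ∈ Set.Icc (minVal (ballImage g c) x) (maxVal (ballImage g c) x) := by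
  rw [minVal_ballImage, maxVal_ballImage]
  exact ⟨(image_inner_ballImage g c x).1.2 ⟨θ, hθ, rfl⟩,
    (image_inner_ballImage g c x).2.2 ⟨θ, hθ, rfl⟩⟩

theorem det_dualMap {d : ℕ} (g : (𝔼 d) ≃ₗ[ℝ] 𝔼 d) :
    LinearMap.det (dualMap g) = LinearMap.det (g : (𝔼 d) →ₗ[ℝ] 𝔼 d) := by
  set b := EuclideanSpace.basisFun (Fin d) ℝ
  rw [dualMap, ← LinearMap.det_toMatrix b.toBasis, LinearMap.toMatrix_adjoint,
    Matrix.det_conjTranspose, LinearMap.det_toMatrix, star_trivial]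

/-- The map `Q = r • (dualMap g)⁻¹` is a contraction, so its determinant is at most one in absolute
value. -/
theorem pow_le_abs_det {d : ℕ} (g : (𝔼 d) ≃ₗ[ℝ] 𝔼 d) {r : ℝ} (hr : 0 < r)
    (h : ∀ v, r * ‖v‖ ≤ ‖dualMap g v‖) :
    r ^ d ≤ |LinearMap.det (g : (𝔼 d) →ₗ[ℝ] 𝔼 d)| := by
  have hinj : Function.Injective (dualMap g) := by
    rw [injective_iff_map_eq_zero]
    intro v hv
    have := h v
    rw [hv, norm_zero] at this
    rw [← norm_eq_zero]
    nlinarith [norm_nonneg v]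
  set k := LinearEquiv.ofInjectiveEndo (dualMap g) hinj
  have hk : ∀ v, dualMap g (k.symm v) = v := fun v => k.apply_symm_apply v
  set Q := k.symm.trans (LinearEquiv.smulOfNeZero ℝ (𝔼 d) r hr.ne') with hQ
  have hQv : ∀ v, Q v = r • k.symm v := fun v => rfl
  set b := EuclideanSpace.basisFun (Fin d) ℝ
  have hQb : ∀ j, ‖Q (b j)‖ ^ 2 ≤ 1 := by
    intro j
    rw [sq_le_one_iff₀ (norm_nonneg _), hQv, norm_smul, Real.norm_of_nonneg hr.le]
    refine (h _).trans ?_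
    rw [hk, b.norm_eq_one]
  have h1 := (abs_det_le_one_of_sum_norm_sq_le b Q (by
    simpa using Finset.sum_le_sum fun j (_ : j ∈ Finset.univ) => hQb j)).1
  have h2 : LinearMap.det (Q : (𝔼 d) →ₗ[ℝ] 𝔼 d) * LinearMap.det (dualMap g) = r ^ d := by
    rw [← LinearMap.det_comp]
    have : (Q : (𝔼 d) →ₗ[ℝ] 𝔼 d) ∘ₗ dualMap g = r • LinearMap.id := by
      ext1 v
      rw [LinearMap.comp_apply, LinearEquiv.coe_coe, hQv]
      simp only [LinearMap.smul_apply, LinearMap.id_apply]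
      congr 1
      exact k.symm_apply_apply v
    rw [this, LinearMap.det_smul]
    simp
  rw [det_dualMap] at h2
  have h3 : |LinearMap.det (Q : (𝔼 d) →ₗ[ℝ] 𝔼 d)| * |LinearMap.det (g : (𝔼 d) →ₗ[ℝ] 𝔼 d)| =
      r ^ d := by
    rw [← abs_mul, h2, abs_of_pos (by positivity)]
  nlinarith [abs_det_pos g]

/-! ### One cut -/

/-- Uses `log (1 + 1/d) ≥ 2/(2d+1)` along the axis and `log u ≤ u - 1` for `u = radialScale²` across
it. The constant `5/12` is what the sum of the two bounds gives at `d = 1`. -/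
theorem halfShape_det_le {d : ℕ} (hd : 1 ≤ d) :
    axialScale d * radialScale d ^ (d - 1) ≤ Real.exp (-(5 / (12 * d))) := by
  have hd0 : (1 : ℝ) ≤ d := by exact_mod_cast hd
  have hα := axialScale_pos hd
  have hβ := radialScale_pos hd
  rw [← Real.log_le_iff_le_exp (by positivity), Real.log_mul hα.ne' (by positivity), Real.log_pow,
    Nat.cast_sub hd, Nat.cast_one]
  have h1 : Real.log (axialScale d) ≤ -(2 / (2 * d + 1)) := by
    have h := Real.le_log_one_add_of_nonneg (x := (d : ℝ)⁻¹) (by positivity)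
    have e1 : axialScale d = (1 + (d : ℝ)⁻¹)⁻¹ := by unfold axialScale; field_simp
    have e2 : 2 * (d : ℝ)⁻¹ / ((d : ℝ)⁻¹ + 2) = 2 / (2 * d + 1) := by field_simp; ring
    rw [e1, Real.log_inv]
    linarith
  have h2 : ((d : ℝ) - 1) * Real.log (radialScale d) ≤ 1 / (2 * (d + 1)) := by
    rcases Nat.eq_or_lt_of_le hd with h | h
    · subst h; norm_num
    · have hd2 : (2 : ℝ) ≤ d := by exact_mod_cast h
      have h3 : 2 * Real.log (radialScale d) ≤ (d : ℝ) ^ 2 / ((d : ℝ) ^ 2 - 1) - 1 := by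
        have : Real.log (radialScale d ^ 2) ≤ radialScale d ^ 2 - 1 :=
          Real.log_le_sub_one_of_pos (by positivity)
        rwa [Real.log_pow, radialScale_sq h, Nat.cast_ofNat] at this
      have hne : (d : ℝ) - 1 ≠ 0 := by linarith
      have e : ((d : ℝ) - 1) * ((d : ℝ) ^ 2 / ((d : ℝ) ^ 2 - 1) - 1) = 1 / (d + 1) := by
        have : (d : ℝ) ^ 2 - 1 = (d - 1) * (d + 1) := by ring
        rw [this]
        field_simp
        ring
      have h4 : ((d : ℝ) - 1) * (2 * Real.log (radialScale d)) ≤ 1 / (d + 1) := by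
        rw [← e]
        exact mul_le_mul_of_nonneg_left h3 (by linarith)
      have e2 : (1 : ℝ) / (2 * (d + 1)) = 1 / (d + 1) / 2 := by field_simp
      rw [e2]
      linarith
  have h3 : -(2 / (2 * (d : ℝ) + 1)) + 1 / (2 * (d + 1)) ≤ -(5 / (12 * d)) := by
    rw [← sub_nonneg]
    have : -(5 / (12 * (d : ℝ))) - (-(2 / (2 * (d : ℝ) + 1)) + 1 / (2 * (d + 1))) =
        (2 * (d : ℝ) ^ 2 + 3 * d - 5) / (12 * d * ((2 * d + 1) * (d + 1))) := by
      field_simp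
      ring
    rw [this]
    apply div_nonneg
    · nlinarith
    · positivity
  linarith

/-- A cut in a direction in which the ellipsoid is wide does not make the ellipsoid thin. -/
theorem sq_norm_le_of_wide_cut {d : ℕ} (hd : 1 ≤ d) (p : (𝔼 d) →ₗ[ℝ] 𝔼 d) {κ : ℝ} (hκ : 0 ≤ κ)
    (hp : ∀ v, κ * ‖v‖ ^ 2 ≤ ‖p v‖ ^ 2) {x : 𝔼 d} (hx : 0 < ‖p x‖)
    (hwide : 100 * ((d : ℝ) + 1) ^ 2 * κ * ‖x‖ ^ 2 ≤ ‖p x‖ ^ 2) (v : 𝔼 d) :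
    κ * ‖v‖ ^ 2 ≤
      ‖axisScale (‖p x‖⁻¹ • p x) (axialScale d) (radialScale d) (p v)‖ ^ 2 := by
  have hd0 : (1 : ℝ) ≤ d := by exact_mod_cast hd
  have hn : ‖‖p x‖⁻¹ • p x‖ = 1 := by
    rw [norm_smul, norm_inv, norm_norm, inv_mul_cancel₀ hx.ne']
  rw [norm_axisScale_sq hn]
  rcases Nat.eq_or_lt_of_le hd with h1 | h1
  · subst h1
    rw [inner_sq_eq_norm_sq_of_one hn]
    have hx0 : x ≠ 0 := by rintro rfl; simp at hx
    obtain ⟨t, rfl⟩ := exists_smul_eq_of_finrank_eq_one (K := ℝ)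
      (finrank_euclideanSpace_fin (n := 1)) hx0 v
    rw [map_smul, norm_smul, norm_smul, mul_pow, mul_pow]
    have ha : axialScale 1 = 1 / 2 := by norm_num [axialScale]
    rw [ha]
    norm_num at hwide
    have h3 : 0 ≤ κ * ‖x‖ ^ 2 := by positivity
    have h2 : κ * ‖x‖ ^ 2 ≤ ‖p x‖ ^ 2 / 4 := by linarith
    nlinarith [mul_le_mul_of_nonneg_left h2 (sq_nonneg ‖t‖)]
  · have hd2 : (2 : ℝ) ≤ d := by exact_mod_cast h1
    -- `s` is the inverse of `radialScale²`. The goal becomes `2/(d+1) * q²/W ≤ ν`: the loss along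
    -- the cut is covered by the radial expansion.
    set s : ℝ := 1 - 1 / (d : ℝ) ^ 2 with hs
    have hs1 : s ≤ 1 := by
      have : 0 ≤ 1 / (d : ℝ) ^ 2 := by positivity
      linarith
    have hs0 : 0 ≤ s := by
      rw [hs, sub_nonneg, div_le_one (by positivity)]
      nlinarith
    have hpos : ∀ w, 0 ≤ ‖p w‖ ^ 2 - s * κ * ‖w‖ ^ 2 := by
      intro w
      have h := hp w
      have : 0 ≤ κ * ‖w‖ ^ 2 := by positivity
      nlinarith
    set W := ‖p x‖ ^ 2 with hW
    have hWpos : 0 < W := by positivity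
    set ν := ‖p v‖ ^ 2 - s * κ * ‖v‖ ^ 2 with hν
    have hν0 : 0 ≤ ν := hpos v
    set k := s * κ * inner ℝ v x with hk
    set q := inner ℝ (p v) (p x) with hq
    -- Cauchy-Schwarz for the nonnegative quadratic form `‖p w‖² - s κ ‖w‖²`, whose polar form at
    -- `(v, x)` is `q - k`.
    have hCS : (q - k) ^ 2 ≤ ν * W := by
      have hdisc : discrim (W - s * κ * ‖x‖ ^ 2) (2 * (q - k)) ν ≤ 0 := by
        apply discrim_le_zero
        intro t
        have h := hpos (v + t • x)
        rw [map_add, map_smul, norm_add_sq_real, norm_add_sq_real, inner_smul_right,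
          inner_smul_right, norm_smul, norm_smul, mul_pow, mul_pow, Real.norm_eq_abs, sq_abs] at h
        rw [hν, hW, hk, hq]
        linarith
      rw [discrim] at hdisc
      have : 0 ≤ ν * (s * κ * ‖x‖ ^ 2) := by positivity
      linarith
    -- The correction `k` is small because the cut is wide: `κ‖v‖² ≤ d² ν` and `d² κ‖x‖² ≤ W/100`.
    have hk2 : k ^ 2 ≤ ν * W / 100 := by
      have hin : inner ℝ v x ^ 2 ≤ ‖v‖ ^ 2 * ‖x‖ ^ 2 := by
        rw [← mul_pow, ← sq_abs (inner ℝ v x)]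
        exact pow_le_pow_left₀ (abs_nonneg _) (abs_real_inner_le_norm v x) 2
      have hν1 : κ * ‖v‖ ^ 2 ≤ (d : ℝ) ^ 2 * ν := by
        have h := hp v
        have e : (d : ℝ) ^ 2 * ν = (d : ℝ) ^ 2 * (‖p v‖ ^ 2 - κ * ‖v‖ ^ 2) + κ * ‖v‖ ^ 2 := by
          rw [hν, hs]; field_simp; ring
        have : 0 ≤ (d : ℝ) ^ 2 * (‖p v‖ ^ 2 - κ * ‖v‖ ^ 2) :=
          mul_nonneg (by positivity) (by linarith)
        linarith
      have hx1 : (d : ℝ) ^ 2 * (κ * ‖x‖ ^ 2) ≤ W / 100 := by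
        have : (d : ℝ) ^ 2 * (κ * ‖x‖ ^ 2) ≤ ((d : ℝ) + 1) ^ 2 * (κ * ‖x‖ ^ 2) :=
          mul_le_mul_of_nonneg_right (by nlinarith) (by positivity)
        linarith
      calc k ^ 2 = s ^ 2 * (κ ^ 2 * inner ℝ v x ^ 2) := by rw [hk]; ring
        _ ≤ 1 * (κ ^ 2 * (‖v‖ ^ 2 * ‖x‖ ^ 2)) := by gcongr; nlinarith
        _ = (κ * ‖v‖ ^ 2) * (κ * ‖x‖ ^ 2) := by ring
        _ ≤ ((d : ℝ) ^ 2 * ν) * (κ * ‖x‖ ^ 2) := by gcongr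
        _ = ν * ((d : ℝ) ^ 2 * (κ * ‖x‖ ^ 2)) := by ring
        _ ≤ ν * (W / 100) := by gcongr
        _ = ν * W / 100 := by ring
    -- From `|q - k| ≤ √(νW)` and `|k| ≤ √(νW)/10`; the factor is `(11/10)²`.
    have hq2 : q ^ 2 ≤ 121 / 100 * (ν * W) := by
      nlinarith [sq_nonneg ((q - k) - 10 * k)]
    have hinner : inner ℝ (‖p x‖⁻¹ • p x) (p v) ^ 2 = q ^ 2 / W := by
      rw [inner_smul_left, real_inner_comm, mul_pow, conj_trivial, inv_pow, hq, hW]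
      field_simp
    have hqW : q ^ 2 / W ≤ 121 / 100 * ν := by
      rw [div_le_iff₀ hWpos]; linarith
    have hβ := radialScale_sq h1
    have hd1 : 0 < (d : ℝ) ^ 2 - 1 := by nlinarith
    have hβs : radialScale d ^ 2 * s = 1 := by rw [hβ, hs]; field_simp
    have hτ : radialScale d ^ 2 - axialScale d ^ 2 = radialScale d ^ 2 * (2 / (d + 1)) := by
      rw [hβ, axialScale]; field_simp; ring
    have hτ1 : (2 : ℝ) / (d + 1) ≤ 2 / 3 := by gcongr; linarith
    have hτ0 : (0 : ℝ) ≤ 2 / (d + 1) := by positivity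
    -- For `d ≥ 2` the product `2/3 * 121/100` is below one.
    have hτq : 2 / ((d : ℝ) + 1) * (q ^ 2 / W) ≤ ν := by
      have : 2 / ((d : ℝ) + 1) * (q ^ 2 / W) ≤ 2 / 3 * (121 / 100 * ν) := by gcongr
      linarith
    rw [hinner]
    have hβ0 : 0 ≤ radialScale d ^ 2 := by positivity
    calc κ * ‖v‖ ^ 2 = radialScale d ^ 2 * s * (κ * ‖v‖ ^ 2) := by rw [hβs, one_mul]
      _ = radialScale d ^ 2 * (‖p v‖ ^ 2 - ν) := by rw [hν]; ring
      _ ≤ radialScale d ^ 2 * (‖p v‖ ^ 2 - 2 / ((d : ℝ) + 1) * (q ^ 2 / W)) := by gcongr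
      _ = radialScale d ^ 2 * ‖p v‖ ^ 2 +
          (axialScale d ^ 2 - radialScale d ^ 2) * (q ^ 2 / W) := by
        have : axialScale d ^ 2 - radialScale d ^ 2 = -(radialScale d ^ 2 * (2 / (d + 1))) := by
          rw [← hτ]; ring
        rw [this]; ring

/-- `E` is an ellipsoid that contains `θ`, is not thinner than `κ` in any direction, and whose
volume has been reduced by `n` cuts since it was a ball of radius `A`. -/
def Localizes {d : ℕ} (A κ : ℝ) (θ : 𝔼 d) (E : Set (𝔼 d)) (n : ℕ) : Prop :=
  ∃ g c, E = ballImage g c ∧ θ ∈ E ∧ (∀ v, κ * ‖v‖ ^ 2 ≤ ‖dualMap g v‖ ^ 2) ∧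
    |LinearMap.det (g : (𝔼 d) →ₗ[ℝ] 𝔼 d)| ≤ A ^ d * Real.exp (-(5 / (12 * d))) ^ n

/-- `K` need only lie between the open and the closed half, which treats strict and weak cuts alike.
As `axisScale` is self-adjoint, the cut acts on `dualMap g` by composition with `axisScale`. -/
theorem localizes_lownerJohn_half {d : ℕ} (hd : 1 ≤ d) {A B ε : ℝ} (hB : 0 < B) (hε : 0 < ε)
    {g : (𝔼 d) ≃ₗ[ℝ] 𝔼 d} {c θ x : 𝔼 d} {n : ℕ} {K : Set (𝔼 d)}
    (hg : ∀ v, (ε / (20 * B * (d + 1))) ^ 2 * ‖v‖ ^ 2 ≤ ‖dualMap g v‖ ^ 2)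
    (hdet : |LinearMap.det (g : (𝔼 d) →ₗ[ℝ] 𝔼 d)| ≤ A ^ d * Real.exp (-(5 / (12 * d))) ^ n)
    (hx : ‖x‖ ≤ B) (hw : ε ≤ 2 * ‖dualMap g x‖) (hθ : θ ∈ K)
    (hK1 : ∀ η ∈ ballImage g c, inner ℝ x c < inner ℝ x η → η ∈ K)
    (hK2 : ∀ η ∈ K, η ∈ ballImage g c ∧ inner ℝ x c ≤ inner ℝ x η) :
    Localizes A ((ε / (20 * B * (d + 1))) ^ 2) θ (lownerJohn K) (n + 1) := by
  set z := dualMap g x with hz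
  have hz0 : 0 < ‖z‖ := by linarith
  have hn : ‖‖z‖⁻¹ • z‖ = 1 := by
    rw [norm_smul, norm_inv, norm_norm, inv_mul_cancel₀ hz0.ne']
  have hin : ∀ y, inner ℝ (‖z‖⁻¹ • z) y = ‖z‖⁻¹ * inner ℝ z y := fun y => by
    rw [inner_smul_left, conj_trivial]
  have hinv : 0 < ‖z‖⁻¹ := by positivity
  have hLJ := lownerJohn_half hd (K := K) g c hn (fun y hy hny => by
      rw [hin] at hny
      refine hK1 _ (add_mem_ballImage.2 hy) ?_
      rw [inner_add_apply, ← hz]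
      have := (mul_pos_iff_of_pos_left hinv).1 hny
      linarith) (fun y hy => by
      obtain ⟨h1, h2⟩ := hK2 _ hy
      refine ⟨add_mem_ballImage.1 h1, ?_⟩
      rw [inner_add_apply, ← hz] at h2
      rw [hin]
      exact mul_nonneg hinv.le (by linarith))
  have hmem : θ ∈ lownerJohn K := by
    have h2 : ‖g.symm (θ - c)‖ ≤ 1 := (hK2 θ hθ).1
    have hcy : c + g (g.symm (θ - c)) = θ := by simp
    have h3 : 0 ≤ inner ℝ (‖z‖⁻¹ • z) (g.symm (θ - c)) := by
      have h4 := (hK2 θ hθ).2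
      rw [← hcy, inner_add_apply, ← hz] at h4
      rw [hin]
      exact mul_nonneg hinv.le (by linarith)
    have := halfBall_subset hd hn h2 h3
    rw [hLJ, mem_ballImage]
    convert this using 2
    simp only [LinearEquiv.trans_symm, LinearEquiv.trans_apply]
    congr 1
    apply g.injective
    simp [sub_sub]
  refine ⟨_, _, hLJ, hmem, fun v => ?_, ?_⟩
  · have hcomp : dualMap ((halfShape hd _ hn).trans g) v =
        axisScale (‖z‖⁻¹ • z) (axialScale d) (radialScale d) (dualMap g v) := by
      have : ((((halfShape hd _ hn).trans g : (𝔼 d) ≃ₗ[ℝ] 𝔼 d)) : (𝔼 d) →ₗ[ℝ] 𝔼 d) =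
          (g : (𝔼 d) →ₗ[ℝ] 𝔼 d) ∘ₗ axisScale (‖z‖⁻¹ • z) (axialScale d) (radialScale d) := rfl
      rw [dualMap, this, LinearMap.adjoint_comp, adjoint_axisScale]
      rfl
    rw [hcomp]
    refine sq_norm_le_of_wide_cut hd (dualMap g) (sq_nonneg _) hg hz0 ?_ v
    have h1 : ‖x‖ ^ 2 ≤ B ^ 2 := pow_le_pow_left₀ (norm_nonneg _) hx 2
    have h2 : (ε / 2) ^ 2 ≤ ‖z‖ ^ 2 := pow_le_pow_left₀ (by positivity) (by linarith) 2
    -- The constant `20` in `r` is the `10` of the wide-cut condition times `2`, since `ε` bounds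
    -- the full width and `‖z‖` is the half width.
    calc 100 * ((d : ℝ) + 1) ^ 2 * (ε / (20 * B * (d + 1))) ^ 2 * ‖x‖ ^ 2
        ≤ 100 * ((d : ℝ) + 1) ^ 2 * (ε / (20 * B * (d + 1))) ^ 2 * B ^ 2 := by gcongr
      _ = (ε / 2) ^ 2 := by field_simp; norm_num
      _ ≤ ‖z‖ ^ 2 := h2
  · have : LinearMap.det (((halfShape hd _ hn).trans g : (𝔼 d) ≃ₗ[ℝ] 𝔼 d) :
        (𝔼 d) →ₗ[ℝ] 𝔼 d) = LinearMap.det (g : (𝔼 d) →ₗ[ℝ] 𝔼 d) *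
          (axialScale d * radialScale d ^ (d - 1)) := by
      rw [← det_axisScale hd hn, ← LinearMap.det_comp]
      rfl
    have hα := axialScale_pos hd
    have hβ := radialScale_pos hd
    rw [this, abs_mul, abs_of_pos (by positivity : 0 < axialScale d * radialScale d ^ (d - 1)),
      pow_succ, ← mul_assoc (A ^ d)]
    exact mul_le_mul hdet (halfShape_det_le hd) (by positivity) ((abs_nonneg _).trans hdet)

theorem Localizes.count_le {d : ℕ} (hd : 1 ≤ d) {A r : ℝ} (hA : 0 < A) (hr : 0 < r) {θ : 𝔼 d}
    {E : Set (𝔼 d)} {n : ℕ} (h : Localizes A (r ^ 2) θ E n) :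
    (n : ℝ) ≤ 12 / 5 * (d : ℝ) ^ 2 * Real.log (A / r) := by
  obtain ⟨g, c, -, -, hg, hdet⟩ := h
  have hd0 : (0 : ℝ) < d := by exact_mod_cast hd
  have h1 : r ^ d ≤ A ^ d * Real.exp (-(5 / (12 * d))) ^ n :=
    (pow_le_abs_det g hr fun v => by
      have := hg v
      rw [← mul_pow] at this
      exact (sq_le_sq₀ (by positivity) (norm_nonneg _)).1 this).trans hdet
  have h2 := Real.log_le_log (by positivity) h1
  rw [Real.log_mul (by positivity) (by positivity), Real.log_pow, Real.log_pow, Real.log_pow,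
    Real.log_exp] at h2
  rw [Real.log_div hA.ne' hr.ne']
  have h3 : (n : ℝ) * (5 / (12 * d)) ≤ d * (Real.log A - Real.log r) := by linarith
  have h4 := mul_le_mul_of_nonneg_left h3 (by positivity : 0 ≤ 12 / 5 * (d : ℝ))
  have e : 12 / 5 * (d : ℝ) * (n * (5 / (12 * d))) = n := by field_simp
  rw [e] at h4
  linarith

theorem localizes_init {d : ℕ} (hd : 1 ≤ d) {A r : ℝ} (hA : 0 < A) (hr : 0 ≤ r) (hrA : r ≤ A)
    {θ : 𝔼 d} (hθ : ‖θ‖ ≤ A) :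
    Localizes A (r ^ 2) θ (lownerJohn (Metric.closedBall 0 A)) 0 := by
  have hcoe : ((LinearEquiv.smulOfNeZero ℝ (𝔼 d) A hA.ne' : (𝔼 d) ≃ₗ[ℝ] 𝔼 d) :
      (𝔼 d) →ₗ[ℝ] 𝔼 d) = A • LinearMap.id := rfl
  refine ⟨_, _, lownerJohn_closedBall hd hA, ?_, fun v => ?_, ?_⟩
  · have hy : (0 : 𝔼 d) + LinearEquiv.smulOfNeZero ℝ (𝔼 d) A hA.ne' (A⁻¹ • θ) = θ := by
      rw [zero_add]
      exact smul_inv_smul₀ hA.ne' θ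
    rw [lownerJohn_closedBall hd hA, ← hy, add_mem_ballImage, norm_smul, norm_inv,
      Real.norm_of_nonneg hA.le]
    exact inv_mul_le_one_of_le₀ hθ hA.le
  · have : dualMap (LinearEquiv.smulOfNeZero ℝ (𝔼 d) A hA.ne') v = A • v := by
      rw [dualMap, hcoe]
      simp
    rw [this, norm_smul, mul_pow, Real.norm_of_nonneg hA.le]
    gcongr
  · rw [hcoe, LinearMap.det_smul]
    simp [abs_of_pos hA]

/-! ### One round of the algorithm -/

theorem Localizes.inner_mem {d : ℕ} {A κ : ℝ} {θ : 𝔼 d} {E : Set (𝔼 d)} {n : ℕ}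
    (h : Localizes A κ θ E n) (x : 𝔼 d) : inner ℝ x θ ∈ Set.Icc (minVal E x) (maxVal E x) := by
  obtain ⟨g, c, rfl, hθ, -, -⟩ := h
  exact inner_mem_Icc_ballImage hθ x

theorem Localizes.sellerCut {d : ℕ} (hd : 1 ≤ d) {A B ε : ℝ} (hB : 0 < B) (hε : 0 < ε)
    {θ x : 𝔼 d} {E : Set (𝔼 d)} {n : ℕ} (h : Localizes A ((ε / (20 * B * (d + 1))) ^ 2) θ E n)
    (hx : ‖x‖ ≤ B) (hw : ε ≤ maxVal E x - minVal E x) {p : ℝ}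
    (hp : p = (maxVal E x + minVal E x) / 2) :
    Localizes A ((ε / (20 * B * (d + 1))) ^ 2) θ
      (lownerJohn (sellerCut E x p (decide (inner ℝ x θ ≤ p)))) (n + 1) := by
  obtain ⟨g, c, rfl, hθ, hg, hdet⟩ := h
  rw [maxVal_ballImage, minVal_ballImage] at hw hp
  -- The midpoint price cuts exactly through the centre.
  have hpc : p = inner ℝ x c := by rw [hp]; ring
  subst hpc
  by_cases ha : inner ℝ x θ ≤ inner ℝ x c
  · refine localizes_lownerJohn_half hd hB hε (c := c) (x := -x) hg hdet (by rwa [norm_neg])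
      (by rw [map_neg, norm_neg]; linarith) ?_ ?_ ?_
    · simp [BilateralTrade.sellerCut, ha, hθ]
    · intro η hη hlt
      simp only [inner_neg_left, neg_lt_neg_iff] at hlt
      simp [BilateralTrade.sellerCut, ha, hη, hlt.le]
    · intro η hη
      simpa [BilateralTrade.sellerCut, ha] using hη
  · refine localizes_lownerJohn_half hd hB hε (c := c) (x := x) hg hdet hx (by linarith) ?_ ?_ ?_
    · simp only [BilateralTrade.sellerCut, ha, decide_false, Bool.false_eq_true, if_false]
      exact ⟨hθ, not_le.1 ha⟩
    · intro η hη hlt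
      simp [BilateralTrade.sellerCut, ha, hη, hlt]
    · intro η hη
      simp only [BilateralTrade.sellerCut, ha, decide_false, Bool.false_eq_true, if_false] at hη
      exact ⟨hη.1, le_of_lt hη.2⟩

theorem Localizes.buyerCut {d : ℕ} (hd : 1 ≤ d) {A B ε : ℝ} (hB : 0 < B) (hε : 0 < ε)
    {θ x : 𝔼 d} {E : Set (𝔼 d)} {n : ℕ} (h : Localizes A ((ε / (20 * B * (d + 1))) ^ 2) θ E n)
    (hx : ‖x‖ ≤ B) (hw : ε ≤ maxVal E x - minVal E x) {p : ℝ}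
    (hp : p = (maxVal E x + minVal E x) / 2) :
    Localizes A ((ε / (20 * B * (d + 1))) ^ 2) θ
      (lownerJohn (buyerCut E x p (decide (p ≤ inner ℝ x θ)))) (n + 1) := by
  obtain ⟨g, c, rfl, hθ, hg, hdet⟩ := h
  rw [maxVal_ballImage, minVal_ballImage] at hw hp
  have hpc : p = inner ℝ x c := by rw [hp]; ring
  subst hpc
  by_cases ha : inner ℝ x c ≤ inner ℝ x θ
  · refine localizes_lownerJohn_half hd hB hε (c := c) (x := x) hg hdet hx (by linarith) ?_ ?_ ?_
    · simp [BilateralTrade.buyerCut, ha, hθ]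
    · intro η hη hlt
      simp [BilateralTrade.buyerCut, ha, hη, hlt.le]
    · intro η hη
      simpa [BilateralTrade.buyerCut, ha] using hη
  · refine localizes_lownerJohn_half hd hB hε (c := c) (x := -x) hg hdet (by rwa [norm_neg])
      (by rw [map_neg, norm_neg]; linarith) ?_ ?_ ?_
    · simp only [BilateralTrade.buyerCut, ha, decide_false, Bool.false_eq_true, if_false]
      exact ⟨hθ, not_le.1 ha⟩
    · intro η hη hlt
      simp only [inner_neg_left, neg_lt_neg_iff] at hlt
      simp [BilateralTrade.buyerCut, ha, hη, hlt]
    · intro η hη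
      simp only [BilateralTrade.buyerCut, ha, decide_false, Bool.false_eq_true, if_false] at hη
      refine ⟨hη.1, ?_⟩
      rw [inner_neg_left, inner_neg_left]
      exact neg_le_neg (le_of_lt hη.2)

/-- With a single price, a trade forces `s ≤ p ≤ b`. -/
theorem gft_same_price_nonneg (s b p : ℝ) : 0 ≤ gft s b p p := by
  unfold gft
  split_ifs with h
  · linarith [h.1, h.2]
  · exact le_rfl

theorem max_inner_sub_le {d : ℕ} {A B : ℝ} (hA : 0 ≤ A) {θs θb x : 𝔼 d} (hs : ‖θs‖ ≤ A)
    (hb : ‖θb‖ ≤ A) (hx : ‖x‖ ≤ B) : max (inner ℝ x (θb - θs)) 0 ≤ 2 * A * B := by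
  have hB : 0 ≤ B := (norm_nonneg x).trans hx
  refine max_le ?_ (by positivity)
  calc inner ℝ x (θb - θs) ≤ ‖x‖ * ‖θb - θs‖ := real_inner_le_norm _ _
    _ ≤ B * (2 * A) := by
      gcongr
      exact (norm_sub_le _ _).trans (by linarith)
    _ = 2 * A * B := by ring

/-- In potential form, so that summing over rounds telescopes: each new cut pays `2AB`. The extra
`2ε` is granted in every round, though only the last case needs it. -/
theorem EPBT_round {d : ℕ} (hd : 1 ≤ d) {A B ε : ℝ} (hA : 0 < A) (hB : 0 < B) (hε : 0 < ε)
    {θs θb x : 𝔼 d} {Es Eb : Set (𝔼 d)} {ns nb : ℕ}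
    (hs : Localizes A ((ε / (20 * B * (d + 1))) ^ 2) θs Es ns)
    (hb : Localizes A ((ε / (20 * B * (d + 1))) ^ 2) θb Eb nb)
    (hθs : ‖θs‖ ≤ A) (hθb : ‖θb‖ ≤ A) (hx : ‖x‖ ≤ B) :
    ∃ ns' nb' : ℕ,
      Localizes A ((ε / (20 * B * (d + 1))) ^ 2) θs
        ((EPBT d ε A).update (Es, Eb) x (twoBit (inner ℝ x θs) (inner ℝ x θb)
          (epbtPrice ε Es Eb x) (epbtPrice ε Es Eb x))).1 ns' ∧
      Localizes A ((ε / (20 * B * (d + 1))) ^ 2) θb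
        ((EPBT d ε A).update (Es, Eb) x (twoBit (inner ℝ x θs) (inner ℝ x θb)
          (epbtPrice ε Es Eb x) (epbtPrice ε Es Eb x))).2 nb' ∧
      max (inner ℝ x (θb - θs)) 0 - gft (inner ℝ x θs) (inner ℝ x θb)
          (epbtPrice ε Es Eb x) (epbtPrice ε Es Eb x) ≤
        2 * A * B * ((ns' + nb' : ℝ) - (ns + nb)) + 2 * ε := by
  have hsI := hs.inner_mem x
  have hbI := hb.inner_mem x
  have hmax := max_inner_sub_le hA.le hθs hθb hx
  have hgft := gft_same_price_nonneg (inner ℝ x θs) (inner ℝ x θb) (epbtPrice ε Es Eb x)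
  have hsub : inner ℝ x (θb - θs) = inner ℝ x θb - inner ℝ x θs := inner_sub_right _ _ _
  by_cases h1 : maxVal Es x < minVal Eb x
  · have hstep : step ε Es Eb x = Step.exploit := by simp [step, h1]
    refine ⟨ns, nb, by simpa [EPBT, hstep] using hs, by simpa [EPBT, hstep] using hb, ?_⟩
    have hp : epbtPrice ε Es Eb x = (maxVal Es x + minVal Eb x) / 2 := by simp [epbtPrice, hstep]
    rw [hp, gft, if_pos ⟨by linarith [hsI.2], by linarith [hbI.1]⟩, hsub,
      max_eq_left (by linarith [hsI.2, hbI.1])]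
    linarith
  by_cases h2 : ε ≤ maxVal Es x - minVal Es x
  · have hstep : step ε Es Eb x = Step.exploreSeller := by simp [step, h1, h2]
    have hp : epbtPrice ε Es Eb x = (maxVal Es x + minVal Es x) / 2 := by simp [epbtPrice, hstep]
    refine ⟨ns + 1, nb, ?_, by simpa [EPBT, hstep] using hb, ?_⟩
    · simpa [EPBT, hstep, twoBit] using hs.sellerCut hd hB hε hx h2 hp
    · push_cast
      linarith
  by_cases h3 : ε ≤ maxVal Eb x - minVal Eb x
  · have hstep : step ε Es Eb x = Step.exploreBuyer := by simp [step, h1, h2, h3]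
    have hp : epbtPrice ε Es Eb x = (maxVal Eb x + minVal Eb x) / 2 := by simp [epbtPrice, hstep]
    refine ⟨ns, nb + 1, by simpa [EPBT, hstep] using hs, ?_, ?_⟩
    · simpa [EPBT, hstep, twoBit] using hb.buyerCut hd hB hε hx h3 hp
    · push_cast
      linarith
  · have hstep : step ε Es Eb x = Step.postAnyway := by simp [step, h1, h2, h3]
    refine ⟨ns, nb, by simpa [EPBT, hstep] using hs, by simpa [EPBT, hstep] using hb, ?_⟩
    push Not at h1 h2 h3
    -- Without separation `minVal Eb x ≤ maxVal Es x`, so the gain is at most the sum of the two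
    -- widths.
    have : max (inner ℝ x (θb - θs)) 0 ≤ 2 * ε := by
      rw [hsub]
      exact max_le (by linarith [hsI.1, hbI.2]) (by linarith)
    linarith

/-! ### The regret -/

theorem EPBT_regret_le {d : ℕ} (hd : 1 ≤ d) {A B ε : ℝ} (hA : 0 < A) (hB : 0 < B) (hε : 0 < ε)
    (hεA : ε / (20 * B * (d + 1)) ≤ A) {θs θb : 𝔼 d} {x : ℕ → 𝔼 d} (hθs : ‖θs‖ ≤ A)
    (hθb : ‖θb‖ ≤ A) {T : ℕ} (hx : ∀ t < T, ‖x t‖ ≤ B) :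
    (EPBT d ε A).regret T θs θb x ≤
      2 * A * B * (24 / 5 * (d : ℝ) ^ 2 * Real.log (A / (ε / (20 * B * (d + 1))))) +
        2 * ε * T := by
  have hr : 0 < ε / (20 * B * (d + 1)) := by positivity
  have key : ∀ t ≤ T, ∃ ns nb : ℕ,
      Localizes A ((ε / (20 * B * (d + 1))) ^ 2) θs ((EPBT d ε A).state θs θb x t).1 ns ∧
      Localizes A ((ε / (20 * B * (d + 1))) ^ 2) θb ((EPBT d ε A).state θs θb x t).2 nb ∧
      (EPBT d ε A).regret t θs θb x ≤ 2 * A * B * (ns + nb) + 2 * ε * t := by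
    intro t
    induction t with
    | zero =>
      intro _
      exact ⟨0, 0, localizes_init hd hA hr.le hεA hθs, localizes_init hd hA hr.le hεA hθb,
        by simp [Learner.regret]⟩
    | succ t ih =>
      intro ht
      obtain ⟨ns, nb, h1, h2, h3⟩ := ih (by omega)
      obtain ⟨ns', nb', h1', h2', h3'⟩ := EPBT_round hd hA hB hε h1 h2 hθs hθb (hx t (by omega))
      refine ⟨ns', nb', h1', h2', ?_⟩
      have e : (EPBT d ε A).regret (t + 1) θs θb x = (EPBT d ε A).regret t θs θb x + _ :=
        Finset.sum_range_succ _ _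
      rw [e]
      refine (add_le_add h3 h3').trans (le_of_eq ?_)
      push_cast
      ring
  obtain ⟨ns, nb, h1, h2, h3⟩ := key T le_rfl
  have hns := h1.count_le hd hA hr
  have hnb := h2.count_le hd hA hr
  refine h3.trans ?_
  gcongr
  linarith

theorem EPBT_regret_le_trivial {d : ℕ} {A B ε : ℝ} (hA : 0 ≤ A) {θs θb : 𝔼 d} {x : ℕ → 𝔼 d}
    (hθs : ‖θs‖ ≤ A) (hθb : ‖θb‖ ≤ A) {T : ℕ} (hx : ∀ t < T, ‖x t‖ ≤ B) :
    (EPBT d ε A).regret T θs θb x ≤ 2 * A * B * T := by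
  have h : ∀ t ∈ Finset.range T, (max (inner ℝ (x t) (θb - θs)) 0 -
      gft (inner ℝ (x t) θs) (inner ℝ (x t) θb)
        ((EPBT d ε A).price ((EPBT d ε A).state θs θb x t) (x t)).1
        ((EPBT d ε A).price ((EPBT d ε A).state θs θb x t) (x t)).2) ≤ 2 * A * B := by
    intro t ht
    have h1 := max_inner_sub_le hA hθs hθb (hx t (Finset.mem_range.1 ht))
    have h2 := gft_same_price_nonneg (inner ℝ (x t) θs) (inner ℝ (x t) θb)
      ((EPBT d ε A).price ((EPBT d ε A).state θs θb x t) (x t)).1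
    exact (sub_le_self _ h2).trans h1
  refine (Finset.sum_le_sum h).trans (le_of_eq ?_)
  rw [Finset.sum_const, Finset.card_range, nsmul_eq_mul, mul_comm]

/-- With few rounds the number of rounds is at most the logarithmic bound. -/
theorem rounds_le_of_log_lt {d T : ℕ} (hd : 1 ≤ d)
    (hT : (d : ℝ) ^ 2 < 20 * ((d : ℝ) + 1) * (T : ℝ))
    (hlog : Real.log (20 * ((d : ℝ) + 1) * (T : ℝ) / (d : ℝ) ^ 2) < 5) :
    (T : ℝ) ≤ 5 * (d : ℝ) ^ 2 * Real.log (20 * ((d : ℝ) + 1) * (T : ℝ) / (d : ℝ) ^ 2) := by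
  have hd0 : (1 : ℝ) ≤ d := by exact_mod_cast hd
  set z := 20 * ((d : ℝ) + 1) * (T : ℝ) / (d : ℝ) ^ 2 with hz
  have hT0 : (0 : ℝ) < T := by
    by_contra h
    push Not at h
    nlinarith
  have hz0 : 0 < z := by positivity
  have hTz : (T : ℝ) = z * (d : ℝ) ^ 2 / (20 * (d + 1)) := by rw [hz]; field_simp
  -- Integrality matters: `d ≥ 20 T + 1` would give `20 (d + 1) T ≤ d² - 1`. This keeps `z`, and
  -- hence `log z`, quantitatively away from the degenerate values `1` and `0`.
  have hdT : d ≤ 20 * T := by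
    by_contra h
    push Not at h
    have h1 : d ^ 2 < 20 * (d + 1) * T := by exact_mod_cast hT
    nlinarith
  have hzd : ((d : ℝ) + 1) / d ≤ z := by
    have : (d : ℝ) ≤ 20 * T := by exact_mod_cast hdT
    rw [hz, div_le_div_iff₀ (by positivity) (by positivity)]
    nlinarith [mul_le_mul_of_nonneg_left this (by positivity : 0 ≤ ((d : ℝ) + 1) * d)]
  have hL : 1 / ((d : ℝ) + 1) ≤ Real.log z := by
    have h1 := Real.one_sub_inv_le_log_of_pos hz0
    have h2 : z⁻¹ ≤ (((d : ℝ) + 1) / d)⁻¹ := inv_anti₀ (by positivity) hzd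
    have h3 : 1 - (((d : ℝ) + 1) / d)⁻¹ = 1 / (d + 1) := by field_simp; ring
    linarith
  -- Equivalent to the goal. If `log z < 1`, then `z ≤ 3` and the right side is at least `100`;
  -- otherwise `z ≤ e⁵ ≤ 200` and it is at least `200`.
  have hzL : z ≤ 100 * ((d : ℝ) + 1) * Real.log z := by
    rcases lt_or_ge (Real.log z) 1 with h | h
    · have h1 : z ≤ 3 := by
        rw [← Real.exp_log hz0]
        exact ((Real.exp_le_exp.2 h.le).trans Real.exp_one_lt_d9.le).trans (by norm_num)
      have h2 := mul_le_mul_of_nonneg_left hL (by positivity : 0 ≤ 100 * ((d : ℝ) + 1))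
      have h3 : 100 * ((d : ℝ) + 1) * (1 / (d + 1)) = 100 := by field_simp
      linarith
    · have h1 : z ≤ 200 := by
        rw [← Real.exp_log hz0]
        have h5 : Real.exp 5 = Real.exp 1 ^ 5 := by rw [← Real.exp_nat_mul]; norm_num
        refine (Real.exp_le_exp.2 hlog.le).trans ?_
        rw [h5]
        exact (pow_le_pow_left₀ (Real.exp_pos _).le Real.exp_one_lt_d9.le 5).trans (by norm_num)
      nlinarith
  rw [hTz, div_le_iff₀ (by positivity)]
  calc z * (d : ℝ) ^ 2 ≤ (100 * ((d : ℝ) + 1) * Real.log z) * (d : ℝ) ^ 2 := by gcongr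
    _ = _ := by ring

end BilateralTrade

theorem theorem1 (d T : ℕ) (A B : ℝ) (hd : 1 ≤ d) (hA : 0 < A) (hB : 0 < B)
    (hT : (d : ℝ) ^ 2 < 20 * ((d : ℝ) + 1) * (T : ℝ)) :
    (BilateralTrade.EPBT d (A * B * (d : ℝ) ^ 2 / (T : ℝ)) A).StrongBudgetBalance ∧
    (BilateralTrade.EPBT d (A * B * (d : ℝ) ^ 2 / (T : ℝ)) A).worstCaseRegret A B T ≤
      ((10 * A * B * (d : ℝ) ^ 2 *
        Real.log (20 * ((d : ℝ) + 1) * (T : ℝ) / (d : ℝ) ^ 2) : ℝ) : EReal) := by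
  refine ⟨fun _ _ => rfl, ?_⟩
  refine iSup_le fun θs => iSup_le fun θb => iSup_le fun x => iSup_le fun hθs =>
    iSup_le fun hθb => iSup_le fun hx => EReal.coe_le_coe_iff.2 ?_
  have hd0 : (1 : ℝ) ≤ d := by exact_mod_cast hd
  have hT0 : (0 : ℝ) < T := by
    by_contra h
    push Not at h
    nlinarith
  set L := Real.log (20 * ((d : ℝ) + 1) * (T : ℝ) / (d : ℝ) ^ 2) with hL
  rcases lt_or_ge L 5 with h | h
  · refine (BilateralTrade.EPBT_regret_le_trivial hA.le hθs hθb hx).trans ?_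
    have := mul_le_mul_of_nonneg_left (BilateralTrade.rounds_le_of_log_lt hd hT h)
      (by positivity : 0 ≤ 2 * A * B)
    linarith
  · have hratio : A / (A * B * (d : ℝ) ^ 2 / T / (20 * B * (d + 1))) =
        20 * ((d : ℝ) + 1) * (T : ℝ) / (d : ℝ) ^ 2 := by field_simp
    -- The lower bound on `T` makes the initial ball at least as thick as `r`.
    have hεA : A * B * (d : ℝ) ^ 2 / T / (20 * B * (d + 1)) ≤ A := by
      rw [← one_le_div (by positivity), hratio, one_le_div (by positivity)]
      exact hT.le
    have hreg := BilateralTrade.EPBT_regret_le hd hA hB (by positivity) hεA hθs hθb hx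
    rw [hratio, ← hL] at hreg
    refine hreg.trans ?_
    have e : 2 * (A * B * (d : ℝ) ^ 2 / T) * T = 2 * (A * B * (d : ℝ) ^ 2) := by field_simp
    rw [e]
    -- The slack `(10 - 48/5) L = (2/5) L` absorbs the `2` from the non-exploring rounds precisely
    -- when `L ≥ 5`.
    have : 0 ≤ A * B * (d : ℝ) ^ 2 * (L - 5) := mul_nonneg (by positivity) (by linarith)
    linarith
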